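/- All spaces are Hausdorff, a compactum is a compact Hausdorff space, and functors $F:\mathbf{Comp}\to\mathbf{Comp}$ act on the category of compacta and continuous maps. A map is skeletal if preimages of nowhere dense sets are nowhere dense. A functor is open (resp. skeletal) if it sends every open surjection between compacta to an open (resp. skeletal) map. It is weakly normal if it preserves injective maps, surjective maps, limits of inverse systems over directed sets, intersections of closed subsets, the empty set and the singleton, and satisfies $w(FX)\le w(X)$ for every infinite compactum $X$ ($w$ is the weight). It is normal if it is weakly normal and preserves preimages, i.e. preserves bicommutativity of squares with injective horizontal maps; here a commutative square $p_Y\circ\tilde f=f\circ p_X$ is bicommutative if $\tilde f(p_X^{-1}(x))=p_Y^{-1}(f(x))$ for all $x$. It is 1-mec if it preserves injective maps, surjective maps, limits of inverse systems, and bicommutativity of squares with $f,\tilde f$ injective, $p_X$ bijective and $X$ finite. For $n\in\mathbb N$ put $F_n(X)=\bigcup\{F\xi(Fn):\xi\in C(n,X)\}\subset FX$, where $n=\{0,\dots,n-1\}$ is discrete; the degree of $F$ is the least $n$ with $F_n=F$. Let $P$ be the functor of regular Borel probability measures with the weak topology. Let $S=\{(\alpha,\beta,\gamma)\in[0,1]^3:\alpha+\beta+\gamma=1\}$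 and $\Delta=\Delta_0\cup\Delta_1\cup\Delta_2$, where $$\Delta_0=\{s\in S:\max s=1\},\quad \Delta_1=\{s\in S:\min s=0,\ \max s\le\tfrac{11}{12}\},\quad \Delta_2=\{s\in S:\min s\ge\tfrac1{12},\ \max s\ge\tfrac34\}.$$ For a compactum $X$ let $$P_\Delta(X)=\{\alpha\delta_x+\beta\delta_y+\gamma\delta_z:(\alpha,\beta,\gamma)\in\Delta,\ x,y,z\in X\}\subset P(X).$$ Then $P_\Delta$ is a (closed) subfunctor of $P$ contained in $P_3$; it is a normal functor of degree $3$; it is skeletal; and it is not open. Consequently the implication "every open 1-mec functor is skeletal" cannot be reversed, even for normal functors of finite degree: it is not true that every skeletal 1-mec functor which is normal and of finite degree is open. -/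

import Mathlib

open CategoryTheory MeasureTheory

universe u

namespace CompFunctor

/-! ### Skeletal maps, weight, bicommutative squares -/

/-- A map is skeletal if the preimage of every nowhere dense set is nowhere dense. -/
def IsSkeletalMap {X Y : Type*} [TopologicalSpace X] [TopologicalSpace Y] (f : X → Y) : Prop :=
  ∀ A : Set Y, IsNowhereDense A → IsNowhereDense (f ⁻¹' A)

/-- The weight of a topological space: the smallest cardinality of a base of its topology. -/
noncomputable def weight (X : Type u) [TopologicalSpace X] : Cardinal.{u} :=
  sInf {κ | ∃ B : Set (Set X), TopologicalSpace.IsTopologicalBasis B ∧ Cardinal.mk B = κ}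

/-- The square with top side `f'`, bottom side `f`, left side `pX` and right side `pY` commutes,
and `f' (pX⁻¹ x) = pY⁻¹ (f x)` for every point `x`. -/
def Bicommutative {X' Y' X Y : CompHaus.{u}}
    (f' : X' ⟶ Y') (pX : X' ⟶ X) (pY : Y' ⟶ Y) (f : X ⟶ Y) : Prop :=
  f' ≫ pY = pX ≫ f ∧ ∀ x : X, f' '' (pX ⁻¹' {x}) = pY ⁻¹' {f x}

/-! ### Properties of functors on compact Hausdorff spaces -/

section Properties

variable (F : CompHaus.{u} ⥤ CompHaus.{u})

def IsMonomorphic : Prop :=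
  ∀ ⦃X Y : CompHaus.{u}⦄ (f : X ⟶ Y), Function.Injective f → Function.Injective (F.map f)

def IsEpimorphic : Prop :=
  ∀ ⦃X Y : CompHaus.{u}⦄ (f : X ⟶ Y), Function.Surjective f → Function.Surjective (F.map f)

/-- `F` is continuous: it preserves limits of inverse systems over directed sets. -/
def IsContinuousFunctor : Prop :=
  ∀ (J : Type u) [Preorder J] [IsDirectedOrder J] [Nonempty J],
    Limits.PreservesLimitsOfShape Jᵒᵖ F

instance (X : CompHaus.{u}) (A : TopologicalSpace.Closeds X) : CompactSpace (A : Set X) :=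
  isCompact_iff_compactSpace.mp A.isClosed.isCompact

/-- A closed subset of a compact Hausdorff space, as a compact Hausdorff space. -/
def closedSub (X : CompHaus.{u}) (A : TopologicalSpace.Closeds X) : CompHaus.{u} :=
  CompHaus.of (A : Set X)

/-- The inclusion of a closed subset. -/
def closedIncl (X : CompHaus.{u}) (A : TopologicalSpace.Closeds X) : closedSub X A ⟶ X :=
  CompHausLike.ofHom (P := fun _ ↦ True) (X := (A : Set X)) (Y := X)
    ⟨Subtype.val, continuous_subtype_val⟩

/-- The set `F A ⊆ F X` for a closed subset `A ⊆ X` (the image of `F` of the inclusion). -/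
def onClosed (X : CompHaus.{u}) (A : TopologicalSpace.Closeds X) : Set (F.obj X) :=
  Set.range (F.map (closedIncl X A))

/-- `F (⋂ A) = ⋂ F A` for every non-empty family of closed subsets of a compact space. -/
def PreservesIntersections : Prop :=
  ∀ (X : CompHaus.{u}) (S : Set (TopologicalSpace.Closeds X)), S.Nonempty →
    onClosed F X (sInf S) = ⋂ A ∈ S, onClosed F X A

def PreservesEmpty : Prop :=
  ∀ X : CompHaus.{u}, IsEmpty X → IsEmpty (F.obj X)

def PreservesSingleton : Prop :=
  ∀ X : CompHaus.{u}, Nonempty X → Subsingleton X →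
    Nonempty (F.obj X) ∧ Subsingleton (F.obj X)

def PreservesWeight : Prop :=
  ∀ X : CompHaus.{u}, Infinite X → weight (F.obj X) ≤ weight X

/-- `F` preserves bicommutativity of squares whose horizontal maps are injective. -/
def PreservesPreimages : Prop :=
  ∀ ⦃X' Y' X Y : CompHaus.{u}⦄ (f' : X' ⟶ Y') (pX : X' ⟶ X) (pY : Y' ⟶ Y) (f : X ⟶ Y),
    Function.Injective f' → Function.Injective f → Bicommutative f' pX pY f →
      Bicommutative (F.map f') (F.map pX) (F.map pY) (F.map f)

/-- `F` preserves bicommutativity of squares whose horizontal maps are injective, whose left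
side is bijective and whose lower left corner is finite. -/
def PreservesFiniteOnePreimages : Prop :=
  ∀ ⦃X' Y' X Y : CompHaus.{u}⦄ (f' : X' ⟶ Y') (pX : X' ⟶ X) (pY : Y' ⟶ Y) (f : X ⟶ Y),
    Function.Injective f' → Function.Injective f → Function.Bijective pX → Finite X →
      Bicommutative f' pX pY f →
        Bicommutative (F.map f') (F.map pX) (F.map pY) (F.map f)

/-- Monomorphic, epimorphic, continuous, and preserving finite 1-preimages. -/
structure IsOneMec : Prop where
  mono : IsMonomorphic F
  epi : IsEpimorphic F
  cont : IsContinuousFunctor F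
  onePreimages : PreservesFiniteOnePreimages F

structure IsWeaklyNormal : Prop where
  mono : IsMonomorphic F
  epi : IsEpimorphic F
  cont : IsContinuousFunctor F
  inter : PreservesIntersections F
  empty : PreservesEmpty F
  singleton : PreservesSingleton F
  weight : PreservesWeight F

structure IsNormal : Prop extends IsWeaklyNormal F where
  preimages : PreservesPreimages F

/-- `F` maps open surjections to open maps. -/
def IsOpenFunctor : Prop :=
  ∀ ⦃X Y : CompHaus.{u}⦄ (f : X ⟶ Y), IsOpenMap f → Function.Surjective f → IsOpenMap (F.map f)

/-- `F` maps open surjections to skeletal maps. -/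
def IsSkeletalFunctor : Prop :=
  ∀ ⦃X Y : CompHaus.{u}⦄ (f : X ⟶ Y), IsOpenMap f → Function.Surjective f →
    IsSkeletalMap (F.map f)

/-- The discrete space with `n` points. -/
def discrete (n : ℕ) : CompHaus.{u} := CompHaus.of (ULift.{u} (Fin n))

/-- `F_n X ⊆ F X`: the elements `(F ξ) b` with `ξ : n → X` and `b ∈ F n`. -/
def level (n : ℕ) (X : CompHaus.{u}) : Set (F.obj X) :=
  {a | ∃ ξ : discrete.{u} n ⟶ X, a ∈ Set.range (F.map ξ)}

/-- `F` has degree `n`: this is the least number with `F_n = F`. -/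
def HasDegree (n : ℕ) : Prop :=
  IsLeast {k : ℕ | ∀ X : CompHaus.{u}, level F k X = Set.univ} n

def HasFiniteDegree : Prop := ∃ n, HasDegree F n

/-- A subfunctor of `F`: a closed subset of each `F X`, stable under all maps `F f`. -/
structure ClosedSubfunctor where
  carrier : ∀ X : CompHaus.{u}, TopologicalSpace.Closeds (F.obj X)
  map_mem : ∀ {X Y : CompHaus.{u}} (f : X ⟶ Y) {a : F.obj X},
    a ∈ carrier X → F.map f a ∈ carrier Y

end Properties

/-- A subfunctor, as a functor. -/
def ClosedSubfunctor.toFunctor {F : CompHaus.{u} ⥤ CompHaus.{u}} (G : ClosedSubfunctor F) :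
    CompHaus.{u} ⥤ CompHaus.{u} where
  obj X := closedSub (F.obj X) (G.carrier X)
  map {X Y} f :=
    CompHausLike.ofHom (P := fun _ ↦ True)
      (X := (G.carrier X : Set (F.obj X))) (Y := (G.carrier Y : Set (F.obj Y)))
      ⟨fun a ↦ ⟨F.map f a.1, G.map_mem f a.2⟩,
        ((F.map f).hom.hom.continuous.comp continuous_subtype_val).subtype_mk _⟩
  map_id X := by
    refine ConcreteCategory.hom_ext _ _ fun a ↦ ?_
    apply Subtype.ext
    change F.map (𝟙 X) a.1 = a.1
    rw [F.map_id]; rfl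
  map_comp f g := by
    refine ConcreteCategory.hom_ext _ _ fun a ↦ ?_
    apply Subtype.ext
    change F.map (f ≫ g) a.1 = F.map g (F.map f a.1)
    rw [F.map_comp]; rfl

/-! ### The functor `P` of probability measures -/

section Radon

variable (X : Type u) [TopologicalSpace X] [MeasurableSpace X] [BorelSpace X]

/-- The regular Borel probability measures on `X`, with the topology of weak convergence. -/
abbrev RadonProb : Type u := {μ : ProbabilityMeasure X // (μ : Measure X).Regular}

variable {X}

theorem continuous_radon_iff {Z : Type*} [TopologicalSpace Z] [CompactSpace X]
    {g : Z → RadonProb X} :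
    Continuous g ↔ ∀ φ : C(X, ℝ), Continuous fun z ↦ ∫ x, φ x ∂((g z).1 : Measure X) := by
  rw [continuous_induced_rng]
  exact ProbabilityMeasure.continuous_iff_forall_continuousMap_continuous_integral

theorem radon_ext [CompactSpace X] [T2Space X] {μ ν : RadonProb X}
    (h : ∀ φ : C(X, ℝ), ∫ x, φ x ∂(μ.1 : Measure X) = ∫ x, φ x ∂(ν.1 : Measure X)) : μ = ν := by
  have : (μ.1 : Measure X).Regular := μ.2
  have : (ν.1 : Measure X).Regular := ν.2
  apply Subtype.ext
  apply Subtype.ext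
  exact Measure.ext_of_integral_eq_on_compactlySupported
    (μ := (μ.1 : Measure X)) (ν := (ν.1 : Measure X)) fun f ↦ h f.toContinuousMap

instance [CompactSpace X] [T2Space X] : T2Space (RadonProb X) := by
  refine T2Space.of_injective_continuous
    (f := fun (μ : RadonProb X) (φ : C(X, ℝ)) ↦ ∫ x, φ x ∂(μ.1 : Measure X)) ?_ ?_
  · exact fun μ ν h ↦ radon_ext fun φ ↦ congrFun h φ
  · exact continuous_pi fun φ ↦ continuous_radon_iff.mp continuous_id φ

instance [CompactSpace X] [T2Space X] : CompactSpace (RadonProb X) := by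
  have key : ∀ μ : ProbabilityMeasure X, ∃ ν : RadonProb X,
      ∀ φ : C(X, ℝ), ∫ x, φ x ∂(μ : Measure X) = ∫ x, φ x ∂(ν.1 : Measure X) := by
    intro μ
    obtain ⟨ν, hreg, hfin, h⟩ := Measure.exists_regular_eq_of_compactSpace (μ : Measure X)
    have hp : IsProbabilityMeasure ν := by
      constructor
      have h1 := h 1
      simp only [BoundedContinuousFunction.coe_one, Pi.one_apply, integral_const, smul_eq_mul,
        mul_one, measureReal_def, measure_univ, ENNReal.toReal_one] at h1
      have h2 := ENNReal.ofReal_toReal (measure_ne_top ν Set.univ)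
      rw [← h2, ← h1, ENNReal.ofReal_one]
    exact ⟨⟨⟨ν, hp⟩, hreg⟩, fun φ ↦ h (BoundedContinuousFunction.mkOfCompact φ)⟩
  choose r hr using key
  have hc : Continuous r := by
    rw [continuous_radon_iff]
    intro φ
    simp_rw [← hr]
    exact ProbabilityMeasure.continuous_integral_continuousMap φ
  have hs : Function.Surjective r := fun ν ↦ ⟨ν.1, radon_ext fun φ ↦ (hr ν.1 φ).symm⟩
  exact hs.compactSpace hc

/-- Push-forward of regular probability measures. -/
noncomputable def RadonProb.map {Y : Type u} [TopologicalSpace Y] [MeasurableSpace Y]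
    [BorelSpace Y] [CompactSpace X] [T2Space X] [T2Space Y] (f : C(X, Y)) (μ : RadonProb X) :
    RadonProb Y :=
  ⟨μ.1.map f.continuous.measurable.aemeasurable, by
    have : (μ.1 : Measure X).Regular := μ.2
    have : ((μ.1 : Measure X).map f).InnerRegularCompactLTTop :=
      Measure.InnerRegularCompactLTTop.map_of_continuous f.continuous
    have : IsFiniteMeasure ((μ.1 : Measure X).map f) := inferInstance
    change ((μ.1 : Measure X).map f).Regular
    infer_instance⟩

theorem RadonProb.continuous_map {Y : Type u} [TopologicalSpace Y] [MeasurableSpace Y]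
    [BorelSpace Y] [CompactSpace X] [T2Space X] [T2Space Y] (f : C(X, Y)) :
    Continuous (RadonProb.map f) :=
  ((ProbabilityMeasure.continuous_map f.continuous).comp continuous_subtype_val).subtype_mk _

/-- The measure `∑ i, w i • δ_{x i}`. -/
noncomputable def atoms (w : Fin 3 → ℝ) (x : Fin 3 → X) : Measure X :=
  ∑ i, ENNReal.ofReal (w i) • Measure.dirac (x i)

theorem atoms_map {Y : Type u} [TopologicalSpace Y] [MeasurableSpace Y] [BorelSpace Y]
    (f : C(X, Y)) (w : Fin 3 → ℝ) (x : Fin 3 → X) : (atoms w x).map f = atoms w (f ∘ x) := by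
  have hf := f.continuous.measurable
  simp only [atoms, Fin.sum_univ_three, Measure.map_add _ _ hf, Measure.map_smul,
    Measure.map_dirac' hf, Function.comp_apply]

theorem atoms_integral [CompactSpace X] [T2Space X] {w : Fin 3 → ℝ} (hw : ∀ i, 0 ≤ w i)
    (x : Fin 3 → X) (φ : C(X, ℝ)) : ∫ y, φ y ∂(atoms w x) = ∑ i, w i * φ (x i) := by
  have hm := φ.continuous.stronglyMeasurable
  rw [atoms, integral_finsetSum_measure]
  · refine Finset.sum_congr rfl fun i _ ↦ ?_
    rw [integral_smul_measure, integral_dirac' _ _ hm, ENNReal.toReal_ofReal (hw i), smul_eq_mul]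
  · intro i _
    exact ((integrable_dirac' hm (by simp)).smul_measure ENNReal.ofReal_ne_top)

theorem atoms_isProbability {X : Type u} [MeasurableSpace X] {w : Fin 3 → ℝ}
    (hw : w ∈ stdSimplex ℝ (Fin 3)) (x : Fin 3 → X) :
    IsProbabilityMeasure (atoms w x) := by
  constructor
  simp only [atoms, Measure.coe_finsetSum, Finset.sum_apply, Measure.smul_apply, measure_univ,
    smul_eq_mul, mul_one]
  rw [← ENNReal.ofReal_sum_of_nonneg fun i _ ↦ hw.1 i, hw.2, ENNReal.ofReal_one]

theorem atoms_regular [CompactSpace X] [T2Space X] {w : Fin 3 → ℝ}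
    (hw : w ∈ stdSimplex ℝ (Fin 3)) (x : Fin 3 → X) : (atoms w x).Regular := by
  have := atoms_isProbability hw x
  have hd : ∀ y : X, (Measure.dirac y).InnerRegular := by
    refine fun y ↦ ⟨fun A hA r hr ↦ ?_⟩
    by_cases hy : y ∈ A
    · exact ⟨{y}, by simpa using hy, isCompact_singleton, by simpa [hy] using hr⟩
    · simp [Measure.dirac_apply' _ hA, hy] at hr
  have : (atoms w x).InnerRegular := by
    unfold atoms
    infer_instance
  infer_instance

end Radon

instance (X : CompHaus.{u}) : MeasurableSpace X := borel X

instance (X : CompHaus.{u}) : BorelSpace X := ⟨rfl⟩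

/-- The functor `P` of (regular Borel) probability measures. -/
noncomputable def P : CompHaus.{u} ⥤ CompHaus.{u} where
  obj X := CompHaus.of (RadonProb X)
  map {X Y} f :=
    CompHausLike.ofHom (P := fun _ ↦ True) (X := RadonProb X) (Y := RadonProb Y)
      ⟨RadonProb.map f.hom.hom, RadonProb.continuous_map f.hom.hom⟩
  map_id X := by
    refine ConcreteCategory.hom_ext _ _ fun μ ↦ ?_
    apply Subtype.ext
    apply Subtype.ext
    exact Measure.map_id
  map_comp {X Y Z} f g := by
    refine ConcreteCategory.hom_ext _ _ fun μ ↦ ?_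
    apply Subtype.ext
    apply Subtype.ext
    exact (Measure.map_map g.hom.hom.continuous.measurable f.hom.hom.continuous.measurable).symm

/-! ### The subfunctor `P_Δ` -/

/-- The set `Δ` of weights: the vertices of the standard 2-simplex, the points of its sides whose
largest coordinate is at most `11/12`, and the points whose coordinates are all at least `1/12`
and whose largest coordinate is at least `3/4`. -/
def Delta : Set (Fin 3 → ℝ) :=
  {w | w ∈ stdSimplex ℝ (Fin 3) ∧ w 0 ⊔ w 1 ⊔ w 2 = 1} ∪
  {w | w ∈ stdSimplex ℝ (Fin 3) ∧ w 0 ⊓ w 1 ⊓ w 2 = 0 ∧ w 0 ⊔ w 1 ⊔ w 2 ≤ 11 / 12} ∪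
  {w | w ∈ stdSimplex ℝ (Fin 3) ∧ 1 / 12 ≤ w 0 ⊓ w 1 ⊓ w 2 ∧ 3 / 4 ≤ w 0 ⊔ w 1 ⊔ w 2}

theorem Delta_subset : Delta ⊆ stdSimplex ℝ (Fin 3) := by
  rintro w ((h | h) | h) <;> exact h.1

theorem isCompact_Delta : IsCompact Delta := by
  refine (isCompact_stdSimplex ℝ (Fin 3)).of_isClosed_subset ?_ Delta_subset
  have hs : IsClosed (stdSimplex ℝ (Fin 3)) := (isCompact_stdSimplex ℝ (Fin 3)).isClosed
  have c : ∀ i : Fin 3, Continuous fun w : Fin 3 → ℝ ↦ w i := fun i ↦ continuous_apply i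
  have cM : Continuous fun w : Fin 3 → ℝ ↦ w 0 ⊔ w 1 ⊔ w 2 := ((c 0).sup (c 1)).sup (c 2)
  have cm : Continuous fun w : Fin 3 → ℝ ↦ w 0 ⊓ w 1 ⊓ w 2 := ((c 0).inf (c 1)).inf (c 2)
  exact ((hs.inter (isClosed_eq cM continuous_const)).union
    (hs.inter ((isClosed_eq cm continuous_const).inter (isClosed_le cM continuous_const)))).union
    (hs.inter ((isClosed_le continuous_const cm).inter (isClosed_le continuous_const cM)))

theorem isClosed_atoms (X : CompHaus.{u}) :
    IsClosed {μ : RadonProb X | ∃ w ∈ Delta, ∃ x : Fin 3 → X, (μ.1 : Measure X) = atoms w x} := by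
  have : CompactSpace Delta := isCompact_iff_compactSpace.mp isCompact_Delta
  let g : Delta × (Fin 3 → X) → RadonProb X := fun p ↦
    ⟨⟨atoms p.1.1 p.2, atoms_isProbability (Delta_subset p.1.2) p.2⟩,
      atoms_regular (Delta_subset p.1.2) p.2⟩
  have hg : Continuous g := by
    rw [continuous_radon_iff]
    intro φ
    have : (fun p : Delta × (Fin 3 → X) ↦ ∫ y, φ y ∂((g p).1 : Measure X)) =
        fun p ↦ ∑ i, p.1.1 i * φ (p.2 i) :=
      funext fun p ↦ atoms_integral (Delta_subset p.1.2).1 p.2 φ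
    rw [this]
    refine continuous_finsetSum _ fun i _ ↦ ?_
    exact ((continuous_apply i).comp (continuous_subtype_val.comp continuous_fst)).mul
      (φ.continuous.comp ((continuous_apply i).comp continuous_snd))
  convert (isCompact_range hg).isClosed using 1
  ext μ
  constructor
  · rintro ⟨w, hw, x, h⟩
    exact ⟨(⟨w, hw⟩, x), Subtype.ext (Subtype.ext h.symm)⟩
  · rintro ⟨⟨⟨w, hw⟩, x⟩, rfl⟩
    exact ⟨w, hw, x, rfl⟩

/-- `P_Δ X` is the set of all measures `α δ_x + β δ_y + γ δ_z` with `(α, β, γ) ∈ Δ` and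
`x, y, z ∈ X`. -/
noncomputable def PDelta : ClosedSubfunctor P.{u} where
  carrier X :=
    ⟨{μ : RadonProb X | ∃ w ∈ Delta, ∃ x : Fin 3 → X, (μ.1 : Measure X) = atoms w x},
      isClosed_atoms X⟩
  map_mem {X Y} f {μ} := by
    rintro ⟨w, hw, x, h⟩
    exact ⟨w, hw, f ∘ x, (congrArg (Measure.map f) h).trans (atoms_map f.hom.hom w x)⟩

end CompFunctor

namespace CompFunctor

/-! ### Parametrization of `P_Δ X` by weights and points -/

/-! Everything is read off the continuous surjection `rep` from `Δ × X³` onto `P_Δ X`. Two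
representations of one measure have the same atoms (`exists_pos_of_rep_eq`), and this gives the
normality axioms that concern supports. Limits come from compactness of the sets of representations,
and weight from `P_Δ X` being a continuous image of `Δ × X³`.

Skeletality reduces to showing that the image of every nonempty open `U` is a neighbourhood of some
point. Take a measure in `U` whose image has as many atoms as possible: atoms with a common image
then lie over an isolated point (`exists_rep_isolated`), since otherwise one of them could be moved.
If `f` is injective on the support, a section of `f` lifts all nearby measures. If all atoms lie
over one isolated point, the image is an isolated Dirac measure. Otherwise exactly two of three
atoms share an isolated image; after the weights are pushed into the interior of `Δ₂`, every measure
near the image still has at most one atom off the isolated point, and it lifts by rescaling the two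
merged weights (`image_mem_nhds_of_doubled`).

Openness fails on the boundary of `Δ₂`: merging the two atoms of weight `1/12` in `(10/12, 1/12,
1/12)` gives a limit of edge measures that have no preimage with three atoms. -/

theorem integral_atoms {X : Type u} [MeasurableSpace X] [MeasurableSingletonClass X]
    {w : Fin 3 → ℝ} (hw : ∀ i, 0 ≤ w i) (x : Fin 3 → X) (φ : X → ℝ) :
    ∫ y, φ y ∂(atoms w x) = ∑ i, w i * φ (x i) := by
  rw [atoms, integral_finsetSum_measure]
  · refine Finset.sum_congr rfl fun i _ ↦ ?_
    rw [integral_smul_measure, integral_dirac, ENNReal.toReal_ofReal (hw i), smul_eq_mul]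
  · exact fun i _ ↦ (integrable_dirac (by simp)).smul_measure ENNReal.ofReal_ne_top

/-- Finite atomic measures integrate every function, so the test functions need not be continuous.
Later they are indicators of points or compositions with discontinuous sections. -/
theorem atoms_eq_iff {X : Type u} [MeasurableSpace X] [MeasurableSingletonClass X]
    {w w' : Fin 3 → ℝ} (hw : ∀ i, 0 ≤ w i) (hw' : ∀ i, 0 ≤ w' i) (x x' : Fin 3 → X) :
    atoms w x = atoms w' x' ↔
      ∀ φ : X → ℝ, ∑ i, w i * φ (x i) = ∑ i, w' i * φ (x' i) := by
  constructor
  · intro h φ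
    rw [← integral_atoms hw, h, integral_atoms hw']
  · intro h
    have key : ∀ {v : Fin 3 → ℝ} (_ : ∀ i, 0 ≤ v i) (z : Fin 3 → X) {s : Set X},
        MeasurableSet s → atoms v z s =
          ENNReal.ofReal (∑ i, v i * s.indicator (fun _ ↦ (1 : ℝ)) (z i)) := by
      intro v hv z s hs
      rw [ENNReal.ofReal_sum_of_nonneg fun i _ ↦
        mul_nonneg (hv i) (Set.indicator_nonneg (fun _ _ ↦ zero_le_one) _)]
      simp only [atoms, Measure.coe_finsetSum, Finset.sum_apply, Measure.smul_apply, smul_eq_mul,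
        Measure.dirac_apply' _ hs]
      refine Finset.sum_congr rfl fun i _ ↦ ?_
      rw [ENNReal.ofReal_mul (hv i)]
      by_cases hz : z i ∈ s <;> simp [hz]
    ext s hs
    rw [key hw x hs, key hw' x' hs, h]

instance (X : CompHaus.{u}) : T1Space X :=
  have : T2Space X := X.is_hausdorff
  T2Space.t1Space

instance (X : CompHaus.{u}) : MeasurableSingletonClass X :=
  OpensMeasurableSpace.toMeasurableSingletonClass

/-- The functor `P_Δ`. -/
noncomputable abbrev PD : CompHaus.{u} ⥤ CompHaus.{u} := PDelta.toFunctor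

/-- The point of `P_Δ X` given by weights and points. -/
noncomputable def rep (X : CompHaus.{u}) (p : Delta × (Fin 3 → X)) : PD.obj X :=
  ⟨⟨⟨atoms p.1.1 p.2, atoms_isProbability (Delta_subset p.1.2) p.2⟩,
      atoms_regular (Delta_subset p.1.2) p.2⟩, p.1.1, p.1.2, p.2, rfl⟩

theorem Delta_nonneg (w : Delta) (i : Fin 3) : 0 ≤ w.1 i := (Delta_subset w.2).1 i

theorem Delta_sum (w : Delta) : w.1 0 + w.1 1 + w.1 2 = 1 := by
  have := (Delta_subset w.2).2
  rwa [Fin.sum_univ_three] at this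

theorem rep_surjective (X : CompHaus.{u}) : Function.Surjective (rep X) := by
  rintro ⟨μ, w, hw, x, h⟩
  exact ⟨(⟨w, hw⟩, x), Subtype.ext (Subtype.ext (Subtype.ext h.symm))⟩

theorem map_rep {X Y : CompHaus.{u}} (f : X ⟶ Y) (w : Delta) (x : Fin 3 → X) :
    PD.map f (rep X (w, x)) = rep Y (w, f ∘ x) :=
  Subtype.ext (Subtype.ext (Subtype.ext (atoms_map f.hom.hom w.1 x)))

theorem rep_eq_rep_iff {X : CompHaus.{u}} {w w' : Delta} {x x' : Fin 3 → X} :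
    rep X (w, x) = rep X (w', x') ↔
      ∀ φ : X → ℝ, ∑ i, w.1 i * φ (x i) = ∑ i, w'.1 i * φ (x' i) := by
  rw [← atoms_eq_iff (Delta_nonneg w) (Delta_nonneg w')]
  constructor
  · intro h
    exact congrArg (fun μ : PD.obj X ↦ (μ.1.1 : Measure X)) h
  · intro h
    exact Subtype.ext (Subtype.ext (Subtype.ext h))

theorem continuous_integral_PD {X : CompHaus.{u}} (φ : C(X, ℝ)) :
    Continuous fun μ : PD.obj X ↦ ∫ y, φ y ∂(μ.1.1 : Measure X) :=
  continuous_radon_iff.mp (continuous_subtype_val (p := fun μ ↦ μ ∈ PDelta.carrier X)) φ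

theorem integral_rep {X : CompHaus.{u}} (φ : X → ℝ) (w : Delta) (x : Fin 3 → X) :
    ∫ y, φ y ∂((rep X (w, x)).1.1 : Measure X) = ∑ i, w.1 i * φ (x i) :=
  integral_atoms (Delta_nonneg w) x φ

theorem continuous_rep (X : CompHaus.{u}) : Continuous (rep X) := by
  refine Continuous.subtype_mk (continuous_radon_iff.mpr fun φ ↦ ?_) _
  have : (fun p : Delta × (Fin 3 → X) ↦ ∫ y, φ y ∂(atoms p.1.1 p.2)) =
      fun p ↦ ∑ i, p.1.1 i * φ (p.2 i) :=
    funext fun p ↦ atoms_integral (Delta_subset p.1.2).1 p.2 φ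
  change Continuous fun p : Delta × (Fin 3 → X) ↦ ∫ y, φ y ∂(atoms p.1.1 p.2)
  rw [this]
  refine continuous_finsetSum _ fun i _ ↦ ?_
  exact ((continuous_apply i).comp (continuous_subtype_val.comp continuous_fst)).mul
    (φ.continuous.comp ((continuous_apply i).comp continuous_snd))

instance : CompactSpace Delta := isCompact_iff_compactSpace.mp isCompact_Delta

theorem isClosedMap_rep (X : CompHaus.{u}) : IsClosedMap (rep X) :=
  (continuous_rep X).isClosedMap

/-- The points of positive weight of one representation occur in every other one. -/
theorem exists_pos_of_rep_eq {X : CompHaus.{u}} {w w' : Delta} {x x' : Fin 3 → X}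
    (h : rep X (w, x) = rep X (w', x')) {i : Fin 3} (hi : 0 < w'.1 i) :
    ∃ j, 0 < w.1 j ∧ x j = x' i := by
  classical
  have h1 := rep_eq_rep_iff.mp h fun y ↦ if y = x' i then 1 else 0
  have h2 : 0 < ∑ j, w'.1 j * (if x' j = x' i then (1 : ℝ) else 0) := by
    refine Finset.sum_pos' (fun j _ ↦ mul_nonneg (Delta_nonneg _ _) (by split_ifs <;> simp))
      ⟨i, Finset.mem_univ _, by simpa using hi⟩
  rw [← h1] at h2
  obtain ⟨j, -, hj⟩ := Finset.exists_ne_zero_of_sum_ne_zero h2.ne'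
  refine ⟨j, (Delta_nonneg w j).lt_of_ne ?_, ?_⟩
  · intro h0
    simp [← h0] at hj
  · by_contra h0
    simp [h0] at hj

theorem exists_pos (w : Delta) : ∃ i, 0 < w.1 i := by
  by_contra! h
  linarith [Delta_sum w, h 0, h 1, h 2]

/-- Points of weight zero do not matter. -/
theorem rep_congr {X : CompHaus.{u}} {w : Delta} {x x' : Fin 3 → X}
    (h : ∀ i, 0 < w.1 i → x i = x' i) : rep X (w, x) = rep X (w, x') := by
  refine rep_eq_rep_iff.mpr fun φ ↦ Finset.sum_congr rfl fun i _ ↦ ?_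
  rcases (Delta_nonneg w i).eq_or_lt with h0 | h0
  · simp [← h0]
  · rw [h i h0]

/-- If `g ∘ f` fixes the points of positive weight in both representations, then equality can
be checked after applying `f`. -/
theorem rep_eq_of_map_eq {X Y : CompHaus.{u}} {f : X → Y} (g : Y → X) {w w' : Delta}
    {x x' : Fin 3 → X} (h : rep Y (w, f ∘ x) = rep Y (w', f ∘ x'))
    (hx : ∀ i, 0 < w.1 i → g (f (x i)) = x i) (hx' : ∀ i, 0 < w'.1 i → g (f (x' i)) = x' i) :
    rep X (w, x) = rep X (w', x') := by
  rw [← rep_congr hx, ← rep_congr hx']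
  exact rep_eq_rep_iff.mpr fun φ ↦ rep_eq_rep_iff.mp h (φ ∘ g)

/-! ### Weights in `Δ` -/

/-- This gap is the reason for the bound `11/12` on the edges: the two weights on an edge sum to
`1`, so each is at least `1/12`. A zero weight therefore stays zero under small perturbations. -/
theorem Delta_zero_or (w : Delta) (i : Fin 3) : w.1 i = 0 ∨ 1 / 12 ≤ w.1 i := by
  have hs := Delta_sum w
  have a := Delta_nonneg w 0
  have b := Delta_nonneg w 1
  have c := Delta_nonneg w 2
  obtain ⟨w, hw⟩ := w
  simp only at *
  suffices h : ∀ j, w j = 0 ∨ 1 / 12 ≤ w j from h i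
  simp only [Fin.forall_fin_succ, IsEmpty.forall_iff, and_true]
  change (w 0 = 0 ∨ 1 / 12 ≤ w 0) ∧ (w 1 = 0 ∨ 1 / 12 ≤ w 1) ∧ (w 2 = 0 ∨ 1 / 12 ≤ w 2)
  rcases hw with (⟨-, h⟩ | ⟨-, h, h'⟩) | ⟨-, h, -⟩
  · grind
  · grind
  · simp only [le_inf_iff] at h
    exact ⟨.inr h.1.1, .inr h.1.2, .inr h.2⟩

/-- Vertices and edges have a zero coordinate, so only `Δ₂` remains. -/
theorem Delta_of_pos (w : Delta) (h : ∀ i, 0 < w.1 i) :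
    (∀ i, 1 / 12 ≤ w.1 i) ∧ ∃ m, 3 / 4 ≤ w.1 m := by
  refine ⟨fun i ↦ (Delta_zero_or w i).resolve_left (h i).ne', ?_⟩
  have hs := Delta_sum w
  have a := h 0
  have b := h 1
  have c := h 2
  obtain ⟨w, hw⟩ := w
  simp only at *
  rcases hw with (⟨-, h⟩ | ⟨-, h, h'⟩) | ⟨-, -, h⟩
  · grind
  · exact absurd h (lt_min (lt_min a b) c).ne'
  · simpa [le_sup_iff, or_assoc, Fin.exists_fin_succ] using h

theorem mem_Delta_of_ge {w : Fin 3 → ℝ} (hs : w 0 + w 1 + w 2 = 1)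
    (h : ∀ i, 1 / 12 ≤ w i) {m : Fin 3} (hm : 3 / 4 ≤ w m) : w ∈ Delta := by
  refine Or.inr ⟨⟨fun i ↦ le_trans (by norm_num) (h i), by rwa [Fin.sum_univ_three]⟩,
    le_inf (le_inf (h 0) (h 1)) (h 2), ?_⟩
  fin_cases m <;> simp_all

theorem mem_Delta_of_vertex : (![1, 0, 0] : Fin 3 → ℝ) ∈ Delta :=
  Or.inl (Or.inl ⟨⟨fun i ↦ by fin_cases i <;> simp, by simp [Fin.sum_univ_three]⟩, by simp⟩)

theorem mem_Delta_of_edge {a : ℝ} (h1 : 1 / 12 ≤ a) (h2 : a ≤ 11 / 12) :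
    (![a, 1 - a, 0] : Fin 3 → ℝ) ∈ Delta := by
  refine Or.inl (Or.inr ⟨⟨fun i ↦ ?_, by simp [Fin.sum_univ_three]⟩, ?_, ?_⟩)
  · fin_cases i <;> simp <;> linarith
  · simp; constructor <;> linarith
  · exact sup_le (sup_le h2 (by simp; linarith)) (by simp; norm_num)

/-! ### Elementary properties of `P_Δ` -/

theorem PD_mono : IsMonomorphic PD.{u} := by
  intro X Y f hf μ ν h
  obtain ⟨⟨w, x⟩, rfl⟩ := rep_surjective X μ
  obtain ⟨⟨w', x'⟩, rfl⟩ := rep_surjective X ν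
  have : Nonempty X := ⟨x 0⟩
  rw [map_rep, map_rep] at h
  exact rep_eq_of_map_eq (Function.invFun f) h (fun i _ ↦ Function.leftInverse_invFun hf _)
    fun i _ ↦ Function.leftInverse_invFun hf _

theorem PD_epi : IsEpimorphic PD.{u} := by
  intro X Y f hf ν
  obtain ⟨⟨w, y⟩, rfl⟩ := rep_surjective Y ν
  obtain ⟨x, rfl⟩ := hf.comp_left y
  exact ⟨rep X (w, x), map_rep f w x⟩

theorem PD_empty : PreservesEmpty PD.{u} := by
  intro X _
  refine ⟨fun μ ↦ ?_⟩
  obtain ⟨⟨w, x⟩, rfl⟩ := rep_surjective X μ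
  exact isEmptyElim (x 0)

theorem PD_singleton : PreservesSingleton PD.{u} := by
  intro X ⟨a⟩ _
  refine ⟨⟨rep X (⟨_, mem_Delta_of_vertex⟩, fun _ ↦ a)⟩, ⟨fun μ ν ↦ ?_⟩⟩
  obtain ⟨⟨w, x⟩, rfl⟩ := rep_surjective X μ
  obtain ⟨⟨w', x'⟩, rfl⟩ := rep_surjective X ν
  refine rep_eq_rep_iff.mpr fun φ ↦ ?_
  have h : ∀ z : Fin 3 → X, ∀ i, φ (z i) = φ a := fun z i ↦ congrArg φ (Subsingleton.elim _ _)
  simp only [h, ← Finset.sum_mul]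
  rw [(Delta_subset w.2).2, (Delta_subset w'.2).2]

/-- A measure lies in the image of an injective map if its atoms do. -/
theorem mem_range_map {X Y : CompHaus.{u}} (f : X ⟶ Y) {w : Delta} {y : Fin 3 → Y}
    (h : ∀ i, 0 < w.1 i → y i ∈ Set.range f) : ∃ x : Fin 3 → X,
      (∀ i, 0 < w.1 i → f (x i) = y i) ∧ PD.map f (rep X (w, x)) = rep Y (w, y) := by
  classical
  -- An atom of positive weight supplies a point of `X`, to which the indices of weight zero can be
  -- sent.
  obtain ⟨i₀, hi₀⟩ := exists_pos w
  have : ∀ i, ∃ a, 0 < w.1 i → f a = y i := by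
    intro i
    by_cases hi : 0 < w.1 i
    · obtain ⟨a, ha⟩ := h i hi
      exact ⟨a, fun _ ↦ ha⟩
    · obtain ⟨a, -⟩ := h i₀ hi₀
      exact ⟨a, fun h ↦ absurd h hi⟩
  choose x hx using this
  exact ⟨x, hx, by rw [map_rep]; exact rep_congr hx⟩

theorem mem_of_rep_mem_range {X Y : CompHaus.{u}} (f : X ⟶ Y) {w : Delta} {y : Fin 3 → Y}
    (h : rep Y (w, y) ∈ Set.range (PD.map f)) {i : Fin 3} (hi : 0 < w.1 i) :
    y i ∈ Set.range f := by
  obtain ⟨μ, hμ⟩ := h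
  obtain ⟨⟨w', x⟩, rfl⟩ := rep_surjective X μ
  rw [map_rep] at hμ
  obtain ⟨j, -, hj⟩ := exists_pos_of_rep_eq hμ hi
  exact ⟨x j, hj⟩

theorem PD_inter : PreservesIntersections PD.{u} := by
  intro X S hS
  have hr : ∀ A : TopologicalSpace.Closeds X, Set.range (closedIncl X A) = (A : Set X) :=
    fun A ↦ Subtype.range_coe
  ext μ
  obtain ⟨⟨w, x⟩, rfl⟩ := rep_surjective X μ
  simp only [Set.mem_iInter, onClosed]
  constructor
  · intro h A hA
    obtain ⟨y, -, hy⟩ := mem_range_map (closedIncl X A) (w := w) (y := x) fun i hi ↦ by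
      have h1 := mem_of_rep_mem_range _ h hi
      rw [hr] at h1 ⊢
      exact (sInf_le hA : sInf S ≤ A) h1
    exact ⟨_, hy⟩
  · intro h
    obtain ⟨y, -, hy⟩ := mem_range_map (closedIncl X (sInf S)) (w := w) (y := x) fun i hi ↦ by
      rw [hr, SetLike.mem_coe, TopologicalSpace.Closeds.mem_sInf]
      intro A hA
      have h1 := mem_of_rep_mem_range _ (h A hA) hi
      rwa [hr] at h1
    exact ⟨_, hy⟩

/-- Each atom of a measure in the fibre lies over an atom coming from `X`; bicommutativity of the
given square puts it in the range of `f'`. -/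
theorem PD_preimages : PreservesPreimages PD.{u} := by
  intro X' Y' X Y f' pX pY f hf' hf hb
  have hc : PD.map f' ≫ PD.map pY = PD.map pX ≫ PD.map f := by
    rw [← PD.map_comp, hb.1, PD.map_comp]
  have hc' : ∀ μ, PD.map pY (PD.map f' μ) = PD.map f (PD.map pX μ) :=
    fun μ ↦ congrArg (fun g : PD.obj X' ⟶ PD.obj Y ↦ g μ) hc
  refine ⟨hc, fun a ↦ Set.Subset.antisymm ?_ ?_⟩
  · rintro _ ⟨μ, rfl, rfl⟩
    exact hc' μ
  · intro ν hν
    obtain ⟨⟨w, y⟩, rfl⟩ := rep_surjective Y' ν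
    obtain ⟨⟨v, x⟩, rfl⟩ := rep_surjective X a
    rw [Set.mem_preimage, Set.mem_singleton_iff, map_rep, map_rep] at hν
    obtain ⟨x', -, hx'⟩ := mem_range_map f' (w := w) (y := y) fun i hi ↦ by
      obtain ⟨j, -, hj⟩ := exists_pos_of_rep_eq hν.symm hi
      have h1 : y i ∈ pY ⁻¹' {f (x j)} := hj.symm
      rw [← hb.2] at h1
      obtain ⟨z, -, hz⟩ := h1
      exact ⟨z, hz⟩
    refine ⟨rep X' (w, x'), PD_mono f hf ?_, hx'⟩
    rw [← hc', hx', map_rep, map_rep, hν]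

/-! ### Degree -/

theorem rep_mem_level {X : CompHaus.{u}} (w : Delta) (x : Fin 3 → X) :
    rep X (w, x) ∈ level PD 3 X := by
  let ξ : discrete.{u} 3 ⟶ X := CompHausLike.ofHom (P := fun _ ↦ True) (X := ULift.{u} (Fin 3))
    (Y := X) ⟨fun i ↦ x i.down, continuous_of_discreteTopology⟩
  exact ⟨ξ, rep (discrete 3) (w, ULift.up), map_rep ξ w _⟩

theorem PD_degree : HasDegree PD.{u} 3 := by
  constructor
  · refine fun X ↦ Set.eq_univ_of_forall fun μ ↦ ?_
    obtain ⟨⟨w, x⟩, rfl⟩ := rep_surjective X μ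
    exact rep_mem_level w x
  · intro k hk
    -- A measure charging all three points of a discrete space comes from `k` points only if those
    -- points map onto the three.
    let w : Delta := ⟨![10 / 12, 1 / 12, 1 / 12],
      mem_Delta_of_ge (m := 0) (by simp; norm_num)
        (fun i ↦ by fin_cases i <;> simp; norm_num) (by simp; norm_num)⟩
    have hw : ∀ i, 0 < w.1 i := fun i ↦ by fin_cases i <;> simp [w]
    have h : rep (discrete 3) (w, ULift.up) ∈ level PD k (discrete 3) :=
      (hk (discrete 3)).symm ▸ Set.mem_univ _
    obtain ⟨ξ, hξ⟩ := h
    have h1 : Function.Surjective ξ := by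
      rintro ⟨i⟩
      exact mem_of_rep_mem_range ξ hξ (hw i)
    have h2 : Nat.card (ULift.{u} (Fin 3)) ≤ Nat.card (ULift.{u} (Fin k)) :=
      Nat.card_le_card_of_surjective (α := ULift.{u} (Fin k)) (β := ULift.{u} (Fin 3)) ξ h1
    simpa using h2

theorem PDelta_subset_level (X : CompHaus.{u}) :
    (PDelta.carrier X : Set (P.obj X)) ⊆ level P.{u} 3 X := by
  intro μ hμ
  obtain ⟨⟨w, x⟩, h⟩ := rep_surjective X ⟨μ, hμ⟩
  obtain ⟨ξ, a, ha⟩ := rep_mem_level w x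
  refine ⟨ξ, a.1, ?_⟩
  rw [h] at ha
  exact congrArg Subtype.val ha

/-! ### Limits -/

section Limits

variable {J : Type u} [Preorder J] [IsDirectedOrder J] [Nonempty J]

/-- Only finitely many points occur in the two representations, so by directedness a single stage
`M` separates them all. A left inverse on those points then transfers equality from stage `M` to the
limit. -/
theorem PD_map_jointly_injective {K : Jᵒᵖ ⥤ CompHaus.{u}} (c : Limits.Cone K)
    (hc : ∀ a b : c.pt, (∀ j, c.π.app j a = c.π.app j b) → a = b) {μ ν : PD.obj c.pt}
    (h : ∀ j, PD.map (c.π.app j) μ = PD.map (c.π.app j) ν) : μ = ν := by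
  classical
  obtain ⟨⟨w, x⟩, rfl⟩ := rep_surjective _ μ
  obtain ⟨⟨w', x'⟩, rfl⟩ := rep_surjective _ ν
  let z : Fin 3 ⊕ Fin 3 → c.pt := Sum.elim x x'
  have hs : ∀ p : (Fin 3 ⊕ Fin 3) × (Fin 3 ⊕ Fin 3), ∃ j : J,
      c.π.app (.op j) (z p.1) = c.π.app (.op j) (z p.2) → z p.1 = z p.2 := by
    intro p
    by_contra! hp
    exact (hp (Classical.arbitrary J)).2 (hc _ _ fun j ↦ (hp j.unop).1)
  choose k hk using hs
  obtain ⟨M, hM⟩ := Finite.exists_le k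
  have hf : z.FactorsThrough (c.π.app (.op M) ∘ z) := by
    intro a b hab
    refine hk (a, b) ?_
    have hw := c.w (homOfLE (hM (a, b))).op
    rw [← hw]
    exact congrArg (K.map _) hab
  let g : K.obj (.op M) → c.pt := Function.extend (c.π.app (.op M) ∘ z) z fun _ ↦ x 0
  have hg : ∀ a, g (c.π.app (.op M) (z a)) = z a := fun a ↦ hf.extend_apply _ a
  have hM' := ((map_rep (Y := K.obj (.op M)) (c.π.app (.op M)) w x).symm.trans (h (.op M))).trans
    (map_rep (Y := K.obj (.op M)) (c.π.app (.op M)) w' x')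
  exact rep_eq_of_map_eq g hM' (fun i _ ↦ hg (.inl i)) fun i _ ↦ hg (.inr i)

/-- The representations of the `μ j` form an inverse system of nonempty compact Hausdorff spaces,
whose limit is nonempty. The transition maps do not touch the weights, so a thread has one common
weight vector. -/
theorem exists_compatible_rep (K : Jᵒᵖ ⥤ CompHaus.{u}) (μ : ∀ j, PD.obj (K.obj j))
    (hμ : ∀ {i j : Jᵒᵖ} (f : i ⟶ j), PD.map (K.map f) (μ i) = μ j) :
    ∃ (w : Delta) (x : ∀ j, Fin 3 → K.obj j), (∀ j, rep (K.obj j) (w, x j) = μ j) ∧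
      ∀ {i j : Jᵒᵖ} (f : i ⟶ j), K.map f ∘ x i = x j := by
  let Z : Jᵒᵖ ⥤ TopCat.{u} :=
    { obj j := TopCat.of {p : Delta × (Fin 3 → K.obj j) // rep (K.obj j) p = μ j}
      map {i j} f := TopCat.ofHom ⟨fun p ↦ ⟨(p.1.1, K.map f ∘ p.1.2), by
          exact (map_rep _ _ _).symm.trans ((congrArg _ p.2).trans (hμ f))⟩, by
          refine Continuous.subtype_mk (Continuous.prodMk (by fun_prop) ?_) _
          refine continuous_pi fun a ↦ (K.map f).hom.hom.continuous.comp ?_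
          exact (continuous_apply a).comp (continuous_snd.comp continuous_subtype_val)⟩
      map_id j := by
        refine ConcreteCategory.hom_ext _ _ fun p ↦ ?_
        apply Subtype.ext
        refine Prod.ext rfl ?_
        funext a
        change K.map (𝟙 j) (p.1.2 a) = p.1.2 a
        rw [K.map_id]; rfl
      map_comp {i j k} f g := by
        refine ConcreteCategory.hom_ext _ _ fun p ↦ ?_
        apply Subtype.ext
        refine Prod.ext rfl ?_
        funext a
        change K.map (f ≫ g) (p.1.2 a) = K.map g (K.map f (p.1.2 a))
        rw [K.map_comp]; rfl }
  have h1 : ∀ j, Nonempty (Z.obj j) := fun j ↦ by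
    obtain ⟨p, hp⟩ := rep_surjective _ (μ j)
    exact ⟨⟨p, hp⟩⟩
  have h2 : ∀ j, CompactSpace (Z.obj j) := fun j ↦
    isCompact_iff_compactSpace.mp
      ((isClosed_singleton (x := μ j)).preimage (continuous_rep (K.obj j))).isCompact
  have h3 : ∀ j, T2Space (Z.obj j) := fun j ↦
    inferInstanceAs (T2Space {p : Delta × (Fin 3 → K.obj j) // rep (K.obj j) p = μ j})
  obtain ⟨u, hu⟩ := TopCat.nonempty_limitCone_of_compact_t2_cofiltered_system.{u, u} Z
  have hw : ∀ i j, i ≤ j → (u (.op j)).1.1 = (u (.op i)).1.1 := fun i j hij ↦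
    congrArg (fun p ↦ p.1.1) (hu (homOfLE hij).op)
  let j₀ := Classical.arbitrary J
  have hw' : ∀ j, (u j).1.1 = (u (.op j₀)).1.1 := by
    intro j
    obtain ⟨k, hk, hk'⟩ := exists_ge_ge j.unop j₀
    rw [← hw _ _ hk', hw _ _ hk]
  refine ⟨(u (.op j₀)).1.1, fun j ↦ (u j).1.2, fun j ↦ ?_, fun f ↦ ?_⟩
  · rw [← hw' j]
    exact (u j).2
  · exact congrArg (fun p ↦ p.1.2) (hu f)

end Limits

/-- A continuous bijection of compacta is an isomorphism, so it suffices that the comparison map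
into the limit is bijective. -/
theorem PD_cont : IsContinuousFunctor PD.{u} := by
  intro J _ _ _
  refine ⟨fun {K} ↦
    Limits.preservesLimit_of_preserves_limit_cone (CompHaus.limitConeIsLimit.{u, u} K) ?_⟩
  let P := CompHaus.limitConeIsLimit.{u, u} (K ⋙ PD)
  let c := CompHaus.limitCone.{u, u} K
  have hfac : ∀ j (μ : PD.obj c.pt),
      (CompHaus.limitCone.{u, u} (K ⋙ PD)).π.app j (P.lift (PD.mapCone c) μ) =
        PD.map (c.π.app j) μ := fun j μ ↦
    congrArg (fun g : PD.obj c.pt ⟶ PD.obj (K.obj j) ↦ g μ) (P.fac (PD.mapCone c) j)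
  have : IsIso (P.lift (PD.mapCone c)) := by
    refine CompHausLike.isIso_of_bijective _ ⟨fun μ ν h ↦ ?_, fun v ↦ ?_⟩
    · refine PD_map_jointly_injective c (fun a b hab ↦ Subtype.ext (funext hab)) fun j ↦ ?_
      rw [← hfac, ← hfac, h]
    · obtain ⟨w, x, hx, hx'⟩ := exists_compatible_rep K (fun j ↦ v.1 j) fun f ↦ v.2 f
      let z : Fin 3 → c.pt := fun a ↦ ⟨fun j ↦ x j a, fun f ↦ congrFun (hx' f) a⟩
      refine ⟨rep c.pt (w, z), Subtype.ext (funext fun j ↦ ?_)⟩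
      exact (hfac j _).trans ((map_rep (Y := K.obj j) (c.π.app j) w z).trans (hx j))
  exact P.ofPointIso

/-! ### Weight -/

theorem exists_basis_mk_eq_weight (X : Type u) [TopologicalSpace X] :
    ∃ B : Set (Set X), TopologicalSpace.IsTopologicalBasis B ∧ Cardinal.mk B = weight X :=
  csInf_mem (s := {κ | ∃ B : Set (Set X), TopologicalSpace.IsTopologicalBasis B ∧
    Cardinal.mk B = κ}) ⟨_, _, TopologicalSpace.isTopologicalBasis_opens, rfl⟩

/-- In a T1 space a point is determined by the basic sets containing it. -/
theorem infinite_of_isTopologicalBasis {X : Type u} [TopologicalSpace X] [T1Space X] [Infinite X]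
    {B : Set (Set X)} (hB : TopologicalSpace.IsTopologicalBasis B) : Infinite B := by
  by_contra hfin
  rw [not_infinite_iff_finite] at hfin
  have hinj : Function.Injective fun x : X ↦ {b : B | x ∈ b.1} := by
    intro x y hxy
    by_contra hne
    obtain ⟨b, hb, hxb, hby⟩ := hB.exists_subset_of_mem_open (a := x) (u := {y}ᶜ) hne
      isOpen_compl_singleton
    have h1 : (⟨b, hb⟩ : B) ∈ {b : B | y ∈ b.1} := (congrArg (fun s ↦ (⟨b, hb⟩ : B) ∈ s) hxy).mp hxb
    exact hby h1 rfl
  exact not_finite_iff_infinite.mpr ‹_› (Finite.of_injective _ hinj)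

/-- A continuous surjection from a compact space does not raise the weight. -/
theorem weight_le_of_surjective {X Y ι : Type u} [TopologicalSpace X] [CompactSpace X]
    [TopologicalSpace Y] [T2Space Y] [Infinite ι] {b : ι → Set X}
    (hb : TopologicalSpace.IsTopologicalBasis (Set.range b)) {q : X → Y} (hq : Continuous q)
    (hs : Function.Surjective q) : weight Y ≤ Cardinal.mk ι := by
  -- The points whose whole fibre lies in a finite union of basic sets: this set is open because `q`
  -- is closed, and compactness of fibres makes such sets a base.
  let c : Finset ι → Set Y := fun s ↦ (q '' (⋃ i ∈ s, b i)ᶜ)ᶜ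
  have ho : ∀ i, IsOpen (b i) := fun i ↦ hb.isOpen ⟨i, rfl⟩
  have hc : TopologicalSpace.IsTopologicalBasis (Set.range c) := by
    refine TopologicalSpace.isTopologicalBasis_of_isOpen_of_nhds ?_ fun y O hy hO ↦ ?_
    · rintro _ ⟨s, rfl⟩
      exact (hq.isClosedMap _ (isOpen_biUnion fun i _ ↦ ho i).isClosed_compl).isOpen_compl
    · obtain ⟨t, ht, htf, hyt⟩ := ((isClosed_singleton (x := y)).preimage hq).isCompact
        |>.elim_finite_subcover_image (b := {i | b i ⊆ q ⁻¹' O}) (c := b) (fun i _ ↦ ho i) (by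
          intro x hx
          obtain ⟨_, ⟨i, rfl⟩, hxi, hi⟩ := hb.exists_subset_of_mem_open (a := x) (u := q ⁻¹' O)
            (by rw [Set.mem_preimage, show q x = y from hx]; exact hy) (hO.preimage hq)
          exact Set.mem_biUnion (show i ∈ {i | b i ⊆ q ⁻¹' O} from hi) hxi)
      refine ⟨c htf.toFinset, ⟨_, rfl⟩, ?_, ?_⟩
      · rintro ⟨x, hx, hxy⟩
        exact hx (by simpa using hyt hxy)
      · intro z hz
        obtain ⟨x, rfl⟩ := hs z
        by_contra hzO
        refine hz ⟨x, fun hx ↦ hzO ?_, rfl⟩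
        obtain ⟨i, hi, hxi⟩ := Set.mem_iUnion₂.mp hx
        exact ht (htf.mem_toFinset.mp hi) hxi
  calc weight Y ≤ Cardinal.mk (Set.range c) := csInf_le' ⟨_, hc, rfl⟩
    _ ≤ Cardinal.mk (Finset ι) := Cardinal.mk_range_le
    _ = Cardinal.mk ι := Cardinal.mk_finset_of_infinite ι

theorem isTopologicalBasis_prod_pi {D : Type*} {X : Type u} [TopologicalSpace D]
    [TopologicalSpace X] {C : Set (Set D)} {B : Set (Set X)}
    (hC : TopologicalSpace.IsTopologicalBasis C) (hB : TopologicalSpace.IsTopologicalBasis B) :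
    TopologicalSpace.IsTopologicalBasis (Set.range fun p : C × (Fin 3 → B) ↦
      p.1.1 ×ˢ Set.univ.pi fun i ↦ (p.2 i).1) := by
  refine TopologicalSpace.isTopologicalBasis_of_isOpen_of_nhds ?_ ?_
  · rintro _ ⟨p, rfl⟩
    exact (hC.isOpen p.1.2).prod (isOpen_set_pi Set.finite_univ fun i _ ↦ hB.isOpen (p.2 i).2)
  · rintro ⟨w, x⟩ O hwx hO
    obtain ⟨U, V, hU, hV, hw, hx, hUV⟩ := isOpen_prod_iff.mp hO w x hwx
    obtain ⟨v, hv, hvV⟩ := isOpen_pi_iff'.mp hV x hx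
    obtain ⟨c, hc, hwc, hcU⟩ := hC.exists_subset_of_mem_open hw hU
    choose b hb hxb hbv using fun i ↦ hB.exists_subset_of_mem_open (hv i).2 (hv i).1
    refine ⟨_, ⟨(⟨c, hc⟩, fun i ↦ ⟨b i, hb i⟩), rfl⟩, ⟨hwc, fun i _ ↦ hxb i⟩, ?_⟩
    rintro ⟨w', x'⟩ ⟨hw', hx'⟩
    exact hUV ⟨hcU hw', hvV fun i _ ↦ hbv i (hx' i trivial)⟩

theorem PD_weight : PreservesWeight PD.{u} := by
  intro X _
  obtain ⟨B, hB, hBw⟩ := exists_basis_mk_eq_weight X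
  have : Infinite B := infinite_of_isTopologicalBasis hB
  have hC := TopologicalSpace.isBasis_countableBasis Delta
  set C := TopologicalSpace.countableBasis Delta
  have hCc : Countable C := TopologicalSpace.countable_countableBasis Delta
  -- This makes the index set of the product base infinite.
  have : Nonempty C := by
    obtain ⟨c, hc, -⟩ := hC.exists_subset_of_mem_open (Set.mem_univ ⟨_, mem_Delta_of_vertex⟩)
      isOpen_univ
    exact ⟨c, hc⟩
  have : T2Space (PD.obj X) := (PD.obj X).is_hausdorff
  refine (weight_le_of_surjective (isTopologicalBasis_prod_pi hC hB) (continuous_rep X)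
    (rep_surjective X)).trans ?_
  rw [← hBw, Cardinal.mk_prod, Cardinal.mk_arrow]
  have hinf := Cardinal.aleph0_le_mk B
  refine Cardinal.mul_le_of_le hinf ?_ ?_
  · exact (Cardinal.lift_le_aleph0.mpr (Cardinal.mk_le_aleph0)).trans hinf
  · rw [Cardinal.mk_fin, Cardinal.lift_natCast, Cardinal.lift_uzero, Cardinal.lift_uzero]
    exact Cardinal.power_nat_le hinf

theorem PD_isNormal : IsNormal PD.{u} where
  mono := PD_mono
  epi := PD_epi
  cont := PD_cont
  inter := PD_inter
  empty := PD_empty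
  singleton := PD_singleton
  weight := PD_weight
  preimages := PD_preimages

theorem IsNormal.isOneMec {F : CompHaus.{u} ⥤ CompHaus.{u}} (hF : IsNormal F) : IsOneMec F where
  mono := hF.mono
  epi := hF.epi
  cont := hF.cont
  onePreimages _ _ _ _ f' pX pY f hf' hf _ _ h := hF.preimages f' pX pY f hf' hf h

/-! ### `P_Δ` is skeletal -/

open Filter Topology

theorem sum_fin_three_of_ne {i j k : Fin 3} (hij : i ≠ j) (hik : i ≠ k) (hjk : j ≠ k)
    (g : Fin 3 → ℝ) : ∑ a, g a = g i + g j + g k := by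
  have : (Finset.univ : Finset (Fin 3)) = {i, j, k} := by
    revert i j k
    decide
  rw [this, Finset.sum_insert (by simp [hij, hik]), Finset.sum_insert (by simp [hjk]),
    Finset.sum_singleton, add_assoc]

theorem exists_third {i j : Fin 3} (hij : i ≠ j) :
    ∃ k, i ≠ k ∧ j ≠ k ∧ ∀ a, a = i ∨ a = j ∨ a = k := by
  revert i j
  decide

theorem rep_const {X : CompHaus.{u}} {w w' : Delta} {x x' : Fin 3 → X} {s : X}
    (h : ∀ i, 0 < w.1 i → x i = s) (h' : ∀ i, 0 < w'.1 i → x' i = s) :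
    rep X (w, x) = rep X (w', x') := by
  rw [rep_congr (x' := fun _ ↦ s) h, rep_congr (x' := fun _ ↦ s) h']
  refine rep_eq_rep_iff.mpr fun φ ↦ ?_
  rw [← Finset.sum_mul, ← Finset.sum_mul, (Delta_subset w.2).2, (Delta_subset w'.2).2]

section Skeletal

variable {X Y : CompHaus.{u}} {f : X ⟶ Y} {U : Set (PD.obj X)}

/-- Since `rep` is a closed map, neighbourhoods of all points of a fibre cover the preimage of a
neighbourhood of `ν`. Hence every representation of `ν` has to be examined, not just one. -/
theorem image_mem_nhds_of_rep {ν : PD.obj Y}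
    (h : ∀ p, rep Y p = ν → ∀ᶠ p' in 𝓝 p, rep Y p' ∈ PD.map f '' U) :
    PD.map f '' U ∈ 𝓝 ν := by
  have h1 := (isClosedMap_rep Y).eventually_nhds_fiber (p := fun p ↦ rep Y p ∈ PD.map f '' U) ν
    fun p hp ↦ h p hp
  filter_upwards [h1] with ν' hν'
  obtain ⟨p, rfl⟩ := rep_surjective Y ν'
  exact hν' p rfl

theorem eventually_rep_mem_image (hf : IsOpenMap f) (hU : IsOpen U)
    {w : Delta} {x : Fin 3 → X} (h : rep X (w, x) ∈ U) :
    ∀ᶠ p in 𝓝 (w, f ∘ x), rep Y p ∈ PD.map f '' U := by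
  have ho : IsOpenMap (Prod.map id (fun x ↦ f ∘ x) : Delta × (Fin 3 → X) → Delta × (Fin 3 → Y)) :=
    IsOpenMap.id.prodMap (IsOpenMap.piMap (fun _ ↦ hf) (by simp))
  have h1 := (ho _ (hU.preimage (continuous_rep X))).mem_nhds ⟨(w, x), h, rfl⟩
  filter_upwards [h1]
  rintro _ ⟨⟨w', x'⟩, hx', rfl⟩
  exact ⟨_, hx', map_rep f w' x'⟩

/-- `P_Δ f` is open at measures on whose support the open surjection `f` is injective. -/
theorem image_mem_nhds_of_injOn_support (hf : IsOpenMap f) (hs : Function.Surjective f)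
    (hU : IsOpen U) {w : Delta} {x : Fin 3 → X} (h : rep X (w, x) ∈ U)
    (hinj : ∀ i j, 0 < w.1 i → 0 < w.1 j → f (x i) = f (x j) → x i = x j) :
    PD.map f '' U ∈ 𝓝 (rep Y (w, f ∘ x)) := by
  have hg : ∀ y, ∃ a, f a = y ∧ ∀ i, 0 < w.1 i → f (x i) = y → a = x i := by
    intro y
    by_cases hy : ∃ i, 0 < w.1 i ∧ f (x i) = y
    · obtain ⟨i, hi, rfl⟩ := hy
      exact ⟨x i, rfl, fun j hj hji ↦ hinj i j hi hj hji.symm⟩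
    · obtain ⟨a, ha⟩ := hs y
      exact ⟨a, ha, fun i hi hiy ↦ absurd ⟨i, hi, hiy⟩ hy⟩
  -- `g` is a possibly discontinuous section of `f` through the atoms; it turns any representation
  -- of the image into one of the original measure.
  choose g hfg hg using hg
  refine image_mem_nhds_of_rep ?_
  rintro ⟨w', y⟩ hp
  have hy : f ∘ g ∘ y = y := funext fun i ↦ hfg (y i)
  rw [← hy] at hp ⊢
  refine eventually_rep_mem_image hf hU ?_
  rw [rep_eq_of_map_eq g hp (fun i _ ↦ by simp only [Function.comp_apply, hfg])
    fun i hi ↦ hg _ i hi rfl]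
  exact h

/-- The admissible new positions of the `i`-th point form an open set. If its open image were
contained in the finite set of the `f (x j)`, then `f (x i)` would be isolated. -/
theorem exists_update_of_not_isolated (hf : IsOpenMap f) (hU : IsOpen U) {w : Delta}
    {x : Fin 3 → X} (h : rep X (w, x) ∈ U) {i : Fin 3} (hi : ¬ IsOpen {f (x i)}) :
    ∃ a, rep X (w, Function.update x i a) ∈ U ∧ ∀ j, f (x j) ≠ f a := by
  by_contra! hcon
  apply hi
  let N : Set X := {a | rep X (w, Function.update x i a) ∈ U}
  have hN : IsOpen N := hU.preimage ((continuous_rep X).comp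
    (continuous_const.prodMk (continuous_const.update i continuous_id)))
  have hfin : (Set.range (f ∘ x) \ {f (x i)}).Finite := (Set.finite_range _).subset Set.sdiff_subset
  have h1 : {f (x i)} = f '' N \ (Set.range (f ∘ x) \ {f (x i)}) := by
    ext y
    constructor
    · rintro rfl
      refine ⟨⟨x i, ?_, rfl⟩, fun hy ↦ hy.2 rfl⟩
      change rep X (w, Function.update x i (x i)) ∈ U
      rwa [Function.update_eq_self]
    · rintro ⟨⟨a, ha, rfl⟩, hy⟩
      obtain ⟨j, hj⟩ := hcon a ha
      by_contra hne
      exact hy ⟨⟨j, hj⟩, hne⟩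
  rw [h1]
  exact (hf N hN).sdiff hfin.isClosed

open Classical in
/-- The number of atoms of the image under `f` of the measure with weights `w` and atoms `x`. -/
noncomputable def imageCount (f : X ⟶ Y) (w : Delta) (x : Fin 3 → X) : ℕ :=
  ((Finset.univ.filter fun i ↦ 0 < w.1 i).image (f ∘ x)).card

/-- Every nonempty open set of measures contains a measure such that any two atoms with a
common image have an isolated image. -/
theorem exists_rep_isolated (hf : IsOpenMap f) (hU : IsOpen U) (hne : U.Nonempty) :
    ∃ w x, rep X (w, x) ∈ U ∧ ∀ i j, i ≠ j → 0 < w.1 i → 0 < w.1 j → f (x i) = f (x j) →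
      IsOpen {f (x i)} := by
  classical
  let S : Set ℕ := {n | ∃ w x, rep X (w, x) ∈ U ∧ imageCount f w x = n}
  have hS : S.Nonempty := by
    obtain ⟨μ, hμ⟩ := hne
    obtain ⟨⟨w, x⟩, rfl⟩ := rep_surjective X μ
    exact ⟨_, w, x, hμ, rfl⟩
  have hb : BddAbove S := by
    refine ⟨3, ?_⟩
    rintro _ ⟨w, x, -, rfl⟩
    exact Finset.card_image_le.trans ((Finset.card_filter_le _ _).trans (by simp))
  obtain ⟨w, x, hx, hmax⟩ := Nat.sSup_mem hS hb
  refine ⟨w, x, hx, fun i j hij hi hj hfx ↦ ?_⟩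
  by_contra hiso
  obtain ⟨a, ha, haf⟩ := exists_update_of_not_isolated hf hU hx hiso
  have h1 : imageCount f w (Function.update x i a) ≤ sSup S := le_csSup hb ⟨_, _, ha, rfl⟩
  rw [← hmax] at h1
  refine h1.not_gt (Finset.card_lt_card ⟨?_, fun hsub ↦ ?_⟩)
  -- No old image atom is lost, because `j` still covers `f (x i)`; the point `f a` is new, which
  -- contradicts maximality.
  · intro y hy
    simp only [Finset.mem_image, Finset.mem_filter, Finset.mem_univ, true_and,
      Function.comp_apply] at hy ⊢
    obtain ⟨k, hk, rfl⟩ := hy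
    by_cases hki : k = i
    · exact ⟨j, hj, by rw [Function.update_of_ne hij.symm, hki, hfx]⟩
    · exact ⟨k, hk, by rw [Function.update_of_ne hki]⟩
  · have h2 : f a ∈ (Finset.univ.filter fun i ↦ 0 < w.1 i).image (f ∘ x) := by
      refine hsub (Finset.mem_image.mpr ⟨i, by simpa using hi, ?_⟩)
      simp
    obtain ⟨j, -, hj⟩ := Finset.mem_image.mp h2
    exact haf j hj

theorem eventually_zero (w : Delta) (y : Fin 3 → Y) :
    ∀ᶠ p : Delta × (Fin 3 → Y) in 𝓝 (w, y), ∀ a, w.1 a = 0 → p.1.1 a = 0 := by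
  refine eventually_all.mpr fun a ↦ ?_
  by_cases ha : w.1 a = 0
  · have hc : ContinuousAt (fun p : Delta × (Fin 3 → Y) ↦ p.1.1 a) (w, y) :=
      ((continuous_apply a).comp (continuous_subtype_val.comp continuous_fst)).continuousAt
    have h1 : ∀ᶠ p in 𝓝 (w, y), (fun p : Delta × (Fin 3 → Y) ↦ p.1.1 a) p < 1 / 12 :=
      hc.eventually_lt continuousAt_const (by simp only [ha]; norm_num)
    filter_upwards [h1] with p hp _
    exact (Delta_zero_or p.1 a).resolve_right hp.not_ge
  · exact .of_forall fun p h ↦ absurd h ha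

theorem eventually_eq_of_isolated {s : Y} (hs : IsOpen {s}) (w : Delta) (y : Fin 3 → Y) :
    ∀ᶠ p : Delta × (Fin 3 → Y) in 𝓝 (w, y), ∀ a, y a = s → p.2 a = s := by
  refine eventually_all.mpr fun a ↦ ?_
  by_cases ha : y a = s
  · have hc : ContinuousAt (fun p : Delta × (Fin 3 → Y) ↦ p.2 a) (w, y) :=
      ((continuous_apply a).comp continuous_snd).continuousAt
    filter_upwards [hc.preimage_mem_nhds (hs.mem_nhds ha)] with p hp _ using hp
  · exact .of_forall fun p h ↦ absurd h ha

/-- The Dirac measure at an isolated point is isolated. -/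
theorem image_mem_nhds_of_const {s : Y} (hs : IsOpen {s}) {w : Delta} {x : Fin 3 → X}
    (h : rep X (w, x) ∈ U) (hx : ∀ i, 0 < w.1 i → f (x i) = s) :
    PD.map f '' U ∈ 𝓝 (rep Y (w, f ∘ x)) := by
  refine image_mem_nhds_of_rep ?_
  rintro ⟨w', y⟩ hp
  have hy : ∀ i, 0 < w'.1 i → y i = s := by
    intro i hi
    obtain ⟨j, hj, hji⟩ := exists_pos_of_rep_eq hp.symm hi
    exact hji.symm.trans (hx j hj)
  -- Nearby, zero weights stay zero and points at `s` stay at `s`, so the measure is still the Dirac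
  -- measure at `s`.
  filter_upwards [eventually_zero w' y, eventually_eq_of_isolated hs w' y] with ⟨w'', y''⟩ h1 h2
  refine ⟨_, h, ?_⟩
  rw [map_rep]
  refine rep_const (s := s) hx fun i hi ↦ h2 i (hy i ?_)
  exact (Delta_nonneg w' i).lt_of_ne fun h0 ↦ hi.ne' (h1 i h0.symm)

/-- Measures with three atoms have arbitrarily close measures with the same atoms and with
weights in the interior of the last part of `Δ`. -/
theorem exists_strict_weights (hU : IsOpen U) {w : Delta} {x : Fin 3 → X}
    (h : rep X (w, x) ∈ U) (hw : ∀ i, 0 < w.1 i) :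
    ∃ v : Delta, rep X (v, x) ∈ U ∧ (∀ i, 1 / 12 < v.1 i) ∧ ∃ m, 3 / 4 < v.1 m := by
  obtain ⟨hw1, m, hm⟩ := Delta_of_pos w hw
  -- Both constraints of `Δ₂` are strict at `c`, hence by convexity on the segment from `w` to `c`
  -- except possibly at `w`.
  let c : Fin 3 → ℝ := fun a ↦ if a = m then 8 / 10 else 1 / 10
  have hc : ∀ a, 1 / 10 ≤ c a := fun a ↦ by
    simp only [c]
    split_ifs <;> norm_num
  have hcm : c m = 8 / 10 := if_pos rfl
  have hcs : c 0 + c 1 + c 2 = 1 := by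
    simp only [c]
    clear_value c
    fin_cases m <;> simp <;> norm_num
  let t : ℕ → ℝ := fun n ↦ 1 / ((n : ℝ) + 1)
  have ht0 : ∀ n, 0 < t n := fun n ↦ by positivity
  have ht1 : ∀ n, t n ≤ 1 := fun n ↦ by
    rw [div_le_one (by positivity)]
    linarith [n.cast_nonneg (α := ℝ)]
  let g : ℕ → Fin 3 → ℝ := fun n a ↦ w.1 a + t n * (c a - w.1 a)
  have hg1 : ∀ n a, 1 / 12 < g n a := fun n a ↦ by
    simp only [g]
    nlinarith [ht0 n, ht1 n, hc a, hw1 a]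
  have hg2 : ∀ n, 3 / 4 < g n m := fun n ↦ by
    simp only [g]
    nlinarith [ht0 n, ht1 n, hcm]
  have hgD : ∀ n, g n ∈ Delta := fun n ↦
    mem_Delta_of_ge (m := m) (by
      simp only [g]
      linear_combination (1 - t n) * Delta_sum w + t n * hcs) (fun a ↦ (hg1 n a).le) (hg2 n).le
  have hlim : Tendsto (fun n ↦ (⟨g n, hgD n⟩ : Delta)) atTop (𝓝 w) := by
    rw [tendsto_subtype_rng, tendsto_pi_nhds]
    intro a
    have h1 : Tendsto t atTop (𝓝 0) := tendsto_one_div_add_atTop_nhds_zero_nat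
    simpa [g] using tendsto_const_nhds (x := w.1 a) |>.add (h1.mul_const (c a - w.1 a))
  have hco : Continuous fun v : Delta ↦ rep X (v, x) :=
    (continuous_rep X).comp (continuous_id.prodMk continuous_const)
  obtain ⟨n, hn⟩ := (hlim.eventually ((hU.preimage hco).mem_nhds h)).exists
  exact ⟨_, hn, hg1 n, m, hg2 n⟩

/-- The weights obtained from `v` by changing the weight `v k` to `c` and rescaling the others. -/
noncomputable def rescale (v : Fin 3 → ℝ) (k : Fin 3) (c : ℝ) : Fin 3 → ℝ :=
  fun a ↦ if a = k then c else v a * ((1 - c) / (1 - v k))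

theorem rescale_sum {v : Delta} {i j k : Fin 3} (hij : i ≠ j) (hik : i ≠ k) (hjk : j ≠ k)
    (hk : v.1 k < 1) (c : ℝ) : rescale v.1 k c i + rescale v.1 k c j = 1 - c := by
  have hs := (Delta_subset v.2).2
  rw [sum_fin_three_of_ne hij hik hjk] at hs
  have : 1 - v.1 k ≠ 0 := by linarith
  simp only [rescale, if_neg hik, if_neg hjk]
  rw [← add_mul, show v.1 i + v.1 j = 1 - v.1 k by linarith]
  field_simp

theorem continuous_rescale (v : Fin 3 → ℝ) (k : Fin 3) : Continuous (rescale v k) := by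
  refine continuous_pi fun a ↦ ?_
  unfold rescale
  split_ifs <;> fun_prop

theorem rescale_self {v : Fin 3 → ℝ} {k : Fin 3} (hk : v k < 1) : rescale v k (v k) = v := by
  funext a
  have : 1 - v k ≠ 0 := by linarith
  unfold rescale
  split_ifs with h
  · rw [h]
  · rw [div_self this, mul_one]

/-- Strictness enters here: small changes of `v` with total mass `1` remain in `Δ₂`. -/
theorem eventually_rescale {v : Delta} (hv : ∀ i, 1 / 12 < v.1 i) {m : Fin 3} (hm : 3 / 4 < v.1 m)
    {k : Fin 3} (hk : v.1 k < 1) {N : Set Delta} (hN : N ∈ 𝓝 v) :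
    ∀ᶠ c in 𝓝 (v.1 k), ∃ u ∈ N, u.1 = rescale v.1 k c := by
  obtain ⟨N', hN', hNN⟩ := (mem_nhds_subtype _ _ _).mp hN
  have hc : Tendsto (rescale v.1 k) (𝓝 (v.1 k)) (𝓝 v.1) := by
    have := (continuous_rescale v.1 k).tendsto (v.1 k)
    rwa [rescale_self hk] at this
  have h1 : ∀ᶠ u : Fin 3 → ℝ in 𝓝 v.1, ∀ a, 1 / 12 ≤ u a :=
    eventually_all.mpr fun a ↦ ((continuous_apply a).tendsto v.1).eventually_const_le (hv a)
  have h2 : ∀ᶠ u : Fin 3 → ℝ in 𝓝 v.1, 3 / 4 ≤ u m :=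
    ((continuous_apply m).tendsto v.1).eventually_const_le hm
  filter_upwards [hc.eventually hN', hc.eventually h1, hc.eventually h2] with c hc1 hc2 hc3
  have hD : rescale v.1 k c ∈ Delta := by
    refine mem_Delta_of_ge ?_ hc2 hc3
    have : ∃ i j : Fin 3, i ≠ j ∧ i ≠ k ∧ j ≠ k := by
      clear * -
      revert k
      decide
    obtain ⟨i, j, hij, hik, hjk⟩ := this
    rw [← Fin.sum_univ_three, sum_fin_three_of_ne hij hik hjk, rescale_sum hij hik hjk hk]
    simp [rescale]
  exact ⟨⟨_, hD⟩, hNN hc1, rfl⟩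

/-- In a representation of a measure with two atoms which is the image of a measure with strict
weights, the atom that is not doubled has only one representing index. -/
theorem exists_unique_index {v : Delta} (hv : ∀ i, 1 / 12 < v.1 i) {m : Fin 3}
    (hm : 3 / 4 < v.1 m) {i j k : Fin 3} (hij : i ≠ j) (hik : i ≠ k) (hjk : j ≠ k)
    {y : Fin 3 → Y} (hyij : y i = y j) (hyk : y k ≠ y i) {w : Delta} {z : Fin 3 → Y}
    (h : rep Y (w, z) = rep Y (v, y)) :
    ∃ b, w.1 b = v.1 k ∧ z b = y k ∧ ∀ a, a ≠ b → 0 < w.1 a → z a = y i := by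
  classical
  have hv0 : ∀ i, 0 < v.1 i := fun i ↦ lt_trans (by norm_num) (hv i)
  have hall := (exists_third hij)
  obtain ⟨k', hk1, hk2, hall⟩ := hall
  obtain rfl : k = k' := by
    rcases hall k with h | h | h
    · exact absurd h hik.symm
    · exact absurd h hjk.symm
    · exact h
  have hz : ∀ a, 0 < w.1 a → z a = y i ∨ z a = y k := by
    intro a ha
    obtain ⟨b, -, hb⟩ := exists_pos_of_rep_eq h.symm ha
    rcases hall b with rfl | rfl | rfl
    · exact .inl hb.symm
    · exact .inl (hb.symm.trans hyij.symm)
    · exact .inr hb.symm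
  obtain ⟨b, hb, hzb⟩ := exists_pos_of_rep_eq h (hv0 k)
  obtain ⟨d, hd, hzd⟩ := exists_pos_of_rep_eq h (hv0 i)
  have hbd : b ≠ d := by
    rintro rfl
    exact hyk (hzb.symm.trans hzd)
  have heq := rep_eq_rep_iff.mp h fun t ↦ if t = y k then 1 else 0
  rw [sum_fin_three_of_ne hij hik hjk (fun a ↦ v.1 a * _), ← hyij] at heq
  obtain ⟨e, hbe, hde, hall'⟩ := exists_third hbd
  rw [sum_fin_three_of_ne hbd hbe hde] at heq
  simp only [hzb, hzd, if_neg hyk.symm, if_true, mul_zero, mul_one, add_zero, zero_add] at heq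
  have he : 0 < w.1 e → z e = y i := by
    intro he
    refine (hz e he).resolve_right fun hze ↦ ?_
    rw [if_pos hze, mul_one] at heq
    have hw : ∀ a, 0 < w.1 a := by
      intro a
      rcases hall' a with rfl | rfl | rfl <;> assumption
    obtain ⟨hw1, n, hn⟩ := Delta_of_pos w hw
    have hsw := (Delta_subset w.2).2
    have hsv := (Delta_subset v.2).2
    rw [sum_fin_three_of_ne hbd hbe hde] at hsw
    rw [sum_fin_three_of_ne hij hik hjk] at hsv
    have := hw1 b
    have := hw1 d
    have := hw1 e
    have := hv i
    have := hv j
    have := hv k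
    -- If the large weights of `v` and `w` sit at different points, the mass exceeds `3/2`. If they
    -- sit at the same point, the representation splitting that point gives it at least `3/4 +
    -- 1/12`, while the other point is split in the other representation and has at least `1/6`. The
    -- total is `1`, and strictness of `v` makes it exceed `1`.
    rcases hall m with rfl | rfl | rfl <;> rcases hall' n with rfl | rfl | rfl <;> linarith
  refine ⟨b, ?_, hzb, ?_⟩
  · rcases (Delta_nonneg w e).eq_or_lt with h0 | h0
    · rwa [← h0, zero_mul, add_zero] at heq
    · rwa [he h0, if_neg hyk.symm, mul_zero, add_zero] at heq
  · intro a hab ha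
    rcases hall' a with rfl | rfl | rfl
    · exact absurd rfl hab
    · exact hzd
    · exact he ha

/-- Near any representation of the image, only the index `b` can leave the isolated point. The
nearby measure is thus determined by one weight and one point, which are lifted by rescaling `v` and
moving `x k`. -/
theorem image_mem_nhds_of_doubled (hf : IsOpenMap f) (hU : IsOpen U) {v : Delta} {x : Fin 3 → X}
    (h : rep X (v, x) ∈ U) (hv : ∀ i, 1 / 12 < v.1 i) {m : Fin 3} (hm : 3 / 4 < v.1 m)
    {i j k : Fin 3} (hij : i ≠ j) (hik : i ≠ k) (hjk : j ≠ k) (hxij : f (x i) = f (x j))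
    (hxk : f (x k) ≠ f (x i)) (hiso : IsOpen {f (x i)}) :
    PD.map f '' U ∈ 𝓝 (rep Y (v, f ∘ x)) := by
  have hk : v.1 k < 1 := by
    have hs := (Delta_subset v.2).2
    rw [sum_fin_three_of_ne hij hik hjk] at hs
    linarith [hv i, hv j]
  refine image_mem_nhds_of_rep ?_
  rintro ⟨w, y⟩ hp
  obtain ⟨b, hwb, hyb, hya⟩ := exists_unique_index hv hm hij hik hjk hxij hxk hp
  simp only [Function.comp_apply] at hyb hya
  obtain ⟨N, hN, M, hM, hNM⟩ := mem_nhds_prod_iff.mp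
    ((hU.preimage (continuous_rep X)).mem_nhds (show (v, x) ∈ rep X ⁻¹' U from h))
  have hM' : {a | Function.update x k a ∈ M} ∈ 𝓝 (x k) := by
    have hc : Continuous fun a ↦ Function.update x k a :=
      continuous_const.update k continuous_id
    refine hc.continuousAt.preimage_mem_nhds ?_
    rwa [Function.update_eq_self]
  have e1 : ∀ᶠ p : Delta × (Fin 3 → Y) in 𝓝 (w, y), ∃ u ∈ N, u.1 = rescale v.1 k (p.1.1 b) := by
    have hc : ContinuousAt (fun p : Delta × (Fin 3 → Y) ↦ p.1.1 b) (w, y) :=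
      ((continuous_apply b).comp (continuous_subtype_val.comp continuous_fst)).continuousAt
    have he := eventually_rescale hv hm hk hN
    rw [← hwb] at he
    exact hc.eventually he
  have e2 : ∀ᶠ p : Delta × (Fin 3 → Y) in 𝓝 (w, y),
      p.2 b ∈ f '' {a | Function.update x k a ∈ M} := by
    have hc : ContinuousAt (fun p : Delta × (Fin 3 → Y) ↦ p.2 b) (w, y) :=
      ((continuous_apply b).comp continuous_snd).continuousAt
    refine hc.preimage_mem_nhds ?_
    change _ ∈ 𝓝 (y b)
    rw [hyb]
    exact hf.image_mem_nhds hM'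
  filter_upwards [e1, e2, eventually_zero w y, eventually_eq_of_isolated hiso w y]
  rintro ⟨w', y'⟩ ⟨t, htN, ht⟩ ⟨a, haM, ha⟩ h3 h4
  simp only at ht ha h3 h4
  refine ⟨_, hNM (show (t, Function.update x k a) ∈ N ×ˢ M from ⟨htN, haM⟩), ?_⟩
  rw [map_rep]
  have hy' : ∀ c, c ≠ b → 0 < w'.1 c → y' c = f (x i) := fun c hcb hc ↦
    h4 c (hya c hcb ((Delta_nonneg w c).lt_of_ne fun h0 ↦ hc.ne' (h3 c h0.symm)))
  refine rep_eq_rep_iff.mpr fun φ ↦ ?_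
  obtain ⟨d, e, hbd, hbe, hde⟩ : ∃ d e : Fin 3, b ≠ d ∧ b ≠ e ∧ d ≠ e := by
    clear * -
    revert b
    decide
  have hterm : ∀ c, c ≠ b → w'.1 c * φ (y' c) = w'.1 c * φ (f (x i)) := by
    intro c hc
    rcases (Delta_nonneg w' c).eq_or_lt with h0 | h0
    · rw [← h0, zero_mul, zero_mul]
    · rw [hy' c hc h0]
  have hsum := (Delta_subset w'.2).2
  rw [sum_fin_three_of_ne hbd hbe hde] at hsum
  have hres := rescale_sum (v := v) hij hik hjk hk (w'.1 b)
  have hresk : rescale v.1 k (w'.1 b) k = w'.1 b := if_pos rfl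
  rw [sum_fin_three_of_ne hij hik hjk, sum_fin_three_of_ne hbd hbe hde, hterm d hbd.symm,
    hterm e hbe.symm, ht]
  simp only [Function.comp_apply, Function.update_self, Function.update_of_ne hik,
    Function.update_of_ne hjk, ← hxij, ha, hresk]
  linear_combination φ (f (x i)) * (hres - hsum)

theorem exists_image_mem_nhds (hf : IsOpenMap f) (hs : Function.Surjective f) (hU : IsOpen U)
    (hne : U.Nonempty) : ∃ ν, PD.map f '' U ∈ 𝓝 ν := by
  obtain ⟨w, x, hx, hiso⟩ := exists_rep_isolated hf hU hne
  by_cases hinj : ∀ i j, 0 < w.1 i → 0 < w.1 j → f (x i) = f (x j) → x i = x j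
  · exact ⟨_, image_mem_nhds_of_injOn_support hf hs hU hx hinj⟩
  push Not at hinj
  obtain ⟨i, j, hi, hj, hfx, hxij⟩ := hinj
  have hij : i ≠ j := fun h ↦ hxij (congrArg x h)
  have hio := hiso i j hij hi hj hfx
  obtain ⟨k, hik, hjk, hall⟩ := exists_third hij
  by_cases hk : 0 < w.1 k ∧ f (x k) ≠ f (x i)
  · have hw : ∀ a, 0 < w.1 a := by
      intro a
      rcases hall a with rfl | rfl | rfl
      exacts [hi, hj, hk.1]
    obtain ⟨v, hvU, hv, m, hm⟩ := exists_strict_weights hU hx hw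
    exact ⟨_, image_mem_nhds_of_doubled hf hU hvU hv hm hij hik hjk hfx hk.2 hio⟩
  · refine ⟨_, image_mem_nhds_of_const hio hx fun a ha ↦ ?_⟩
    rcases hall a with rfl | rfl | rfl
    · rfl
    · exact hfx.symm
    · by_contra hne
      exact hk ⟨ha, hne⟩

end Skeletal

/-- If the preimage of `closure A` had interior, the image of that interior would be a neighbourhood
of some point inside `closure A`. -/
theorem PD_isSkeletal : IsSkeletalFunctor PD.{u} := by
  intro X Y f hf hs A hA
  have hcl : PD.map f ⁻¹' A ⊆ PD.map f ⁻¹' closure A := Set.preimage_mono subset_closure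
  refine IsNowhereDense.mono hcl ?_
  refine (isClosed_closure.preimage (PD.map f).hom.hom.continuous).isNowhereDense_iff.mpr ?_
  by_contra hne
  obtain ⟨ν, hν⟩ := exists_image_mem_nhds hf hs isOpen_interior (Set.nonempty_iff_ne_empty.mpr hne)
  have h1 : ν ∈ interior (closure A) := by
    refine mem_interior_iff_mem_nhds.mpr (mem_of_superset hν ?_)
    exact Set.image_subset_iff.mpr interior_subset
  rw [hA] at h1
  exact h1

/-! ### `P_Δ` is not open -/

instance (n : ℕ) : DiscreteTopology (discrete.{u} n) :=
  inferInstanceAs (DiscreteTopology (ULift.{u} (Fin n)))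

/-- The points of `discrete n`. -/
def discretePoint {n : ℕ} (i : Fin n) : discrete.{u} n := ULift.up i

theorem discretePoint_injective {n : ℕ} : Function.Injective (discretePoint.{u} (n := n)) :=
  ULift.up_injective

instance (n : ℕ) : DecidableEq (discrete.{u} n) :=
  inferInstanceAs (DecidableEq (ULift.{u} (Fin n)))

/-- The open set of measures on three points that charge every point. -/
theorem isOpen_charging : IsOpen {μ : PD.obj (discrete.{u} 3) |
    ∀ t : discrete.{u} 3, 0 < ∫ y, (if y = t then (1 : ℝ) else 0) ∂(μ.1.1 : Measure _)} := by
  have : Finite (discrete.{u} 3) := inferInstanceAs (Finite (ULift.{u} (Fin 3)))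
  rw [Set.ofPred_forall]
  refine isOpen_iInter_of_finite fun t ↦ isOpen_lt continuous_const ?_
  exact continuous_integral_PD ⟨fun y ↦ if y = t then 1 else 0, continuous_of_discreteTopology⟩

theorem PD_not_isOpen : ¬ IsOpenFunctor PD.{u} := by
  intro hopen
  let f : discrete.{u} 3 ⟶ discrete.{u} 2 := CompHausLike.ofHom (P := fun _ ↦ True)
    (X := ULift.{u} (Fin 3)) (Y := ULift.{u} (Fin 2))
    ⟨fun i ↦ if i.down = 0 then .up 0 else .up 1, continuous_of_discreteTopology⟩
  have hf0 : f (discretePoint 0) = discretePoint 0 := rfl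
  have hf1 : ∀ i : Fin 3, i ≠ 0 → f (discretePoint i) = discretePoint 1 := fun i hi ↦ if_neg hi
  have hs : Function.Surjective f := by
    rintro ⟨i⟩
    fin_cases i
    exacts [⟨.up 0, rfl⟩, ⟨.up 1, rfl⟩]
  have ho := hopen f (fun _ _ ↦ isOpen_discrete _) hs _ isOpen_charging
  set U := {μ : PD.obj (discrete.{u} 3) |
    ∀ t : discrete.{u} 3, 0 < ∫ y, (if y = t then (1 : ℝ) else 0) ∂(μ.1.1 : Measure _)}
  let w : Delta := ⟨![10 / 12, 1 / 12, 1 / 12],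
    mem_Delta_of_ge (m := 0) (by simp; norm_num)
      (fun i ↦ by fin_cases i <;> simp; norm_num) (by simp; norm_num)⟩
  have hw : ∀ i, 0 < w.1 i := fun i ↦ by fin_cases i <;> simp [w]
  have hwU : rep (discrete.{u} 3) (w, discretePoint) ∈ U := by
    rintro ⟨t⟩
    change 0 < ∫ y, (if y = discretePoint t then (1 : ℝ) else 0) ∂_
    rw [integral_rep]
    exact Finset.sum_pos' (fun i _ ↦ mul_nonneg (hw i).le (by split_ifs <;> simp))
      ⟨t, Finset.mem_univ _, by simpa [discretePoint_injective.eq_iff] using hw t⟩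
  -- The approach to `10/12` is from above and stays below `11/12`, so the edge measures belong to
  -- `P_Δ`.
  let a : ℕ → ℝ := fun n ↦ 10 / 12 + 1 / 12 * (1 / ((n : ℝ) + 1))
  have ha1 : ∀ n, 10 / 12 < a n := fun n ↦ by
    have : (0 : ℝ) < 1 / ((n : ℝ) + 1) := by positivity
    simp only [a]
    linarith
  have ha2 : ∀ n, a n ≤ 11 / 12 := fun n ↦ by
    have : 1 / ((n : ℝ) + 1) ≤ 1 := by
      rw [div_le_one (by positivity)]
      linarith [n.cast_nonneg (α := ℝ)]
    simp only [a]
    linarith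
  have ha : Tendsto a atTop (𝓝 (10 / 12)) := by
    simpa only [mul_zero, add_zero] using (tendsto_const_nhds (x := (10 / 12 : ℝ))).add
      ((tendsto_one_div_add_atTop_nhds_zero_nat (𝕜 := ℝ)).const_mul (1 / 12))
  let y : Fin 3 → discrete.{u} 2 := ![discretePoint 0, discretePoint 1, discretePoint 1]
  let v : ℕ → Delta := fun n ↦
    ⟨_, mem_Delta_of_edge (a := a n) (le_trans (by norm_num) (ha1 n).le) (ha2 n)⟩
  let v₀ : Delta := ⟨_, mem_Delta_of_edge (a := 10 / 12) (by norm_num) (by norm_num)⟩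
  have hv : Tendsto v atTop (𝓝 v₀) := by
    rw [tendsto_subtype_rng, tendsto_pi_nhds]
    intro i
    fin_cases i
    · simpa [v, v₀] using ha
    · simpa [v, v₀] using (tendsto_const_nhds (x := (1 : ℝ))).sub ha
    · simp [v, v₀]
  have hv₀ : rep _ (v₀, y) = PD.map f (rep _ (w, discretePoint)) := by
    refine (rep_eq_rep_iff.mpr fun φ ↦ ?_).trans (map_rep f w discretePoint).symm
    simp only [Fin.sum_univ_three, Function.comp_apply, hf0, hf1 1 (by decide), hf1 2 (by decide)]
    simp [v₀, w, y]
    ring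
  have hlim : Tendsto (fun n ↦ rep (discrete.{u} 2) (v n, y)) atTop (𝓝 (rep _ (v₀, y))) :=
    ((continuous_rep (discrete.{u} 2)).tendsto _).comp (hv.prodMk_nhds tendsto_const_nhds)
  obtain ⟨n, μ, hμ, hn⟩ := (hlim.eventually (ho.mem_nhds ⟨_, hwU, hv₀.symm⟩)).exists
  obtain ⟨⟨w', x⟩, rfl⟩ := rep_surjective _ μ
  rw [map_rep] at hn
  have hcharge : ∀ t : Fin 3, ∃ i, 0 < w'.1 i ∧ x i = discretePoint t := by
    intro t
    have h1 := hμ (discretePoint t)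
    rw [integral_rep] at h1
    obtain ⟨i, -, hi⟩ := Finset.exists_ne_zero_of_sum_ne_zero h1.ne'
    refine ⟨i, (Delta_nonneg w' i).lt_of_ne fun h0 ↦ hi ?_, ?_⟩
    · rw [← h0, zero_mul]
    · by_contra h0
      exact hi (by rw [if_neg h0, mul_zero])
  obtain ⟨i, hi, hxi⟩ := hcharge 0
  obtain ⟨j, hj, hxj⟩ := hcharge 1
  obtain ⟨k, hk, hxk⟩ := hcharge 2
  have hne : ∀ {p q : Fin 3} {s t : Fin 3}, x p = discretePoint s → x q = discretePoint t → s ≠ t → p ≠ q := by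
    rintro p q s t hp hq hst rfl
    exact hst (discretePoint_injective (hp.symm.trans hq))
  have hij := hne hxi hxj (by decide)
  have hik := hne hxi hxk (by decide)
  have hjk := hne hxj hxk (by decide)
  have heq := rep_eq_rep_iff.mp hn fun z ↦ if z = discretePoint (1 : Fin 2) then 1 else 0
  rw [sum_fin_three_of_ne hij hik hjk] at heq
  simp only [Function.comp_apply, hxi, hxj, hxk, hf0, hf1 1 (by decide),
    hf1 2 (by decide), Fin.sum_univ_three] at heq
  have h01 : discretePoint.{u} (0 : Fin 2) ≠ discretePoint 1 := discretePoint_injective.ne (by decide)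
  have hy0 : y 0 ≠ discretePoint 1 := h01
  have hy1 : y 1 = discretePoint 1 := rfl
  have hy2 : y 2 = discretePoint 1 := rfl
  rw [if_neg h01, if_neg hy0, if_pos hy1, if_pos hy2, if_pos trivial] at heq
  have hvn1 : (v n).1 1 = 1 - a n := rfl
  have hvn2 : (v n).1 2 = 0 := rfl
  rw [hvn1, hvn2] at heq
  have hj' := (Delta_zero_or w' j).resolve_left hj.ne'
  have hk' := (Delta_zero_or w' k).resolve_left hk.ne'
  -- Two atoms of weight at least `1/12` over the second point force `1 - a n ≥ 1/6`, against `a n >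
  -- 10/12`.
  linarith [ha1 n]

end CompFunctor

theorem mainTheorem9 :
    ((∀ X : CompHaus.{u},
        (CompFunctor.PDelta.carrier X : Set (CompFunctor.P.obj X)) ⊆
          CompFunctor.level CompFunctor.P.{u} 3 X) ∧
      CompFunctor.IsNormal CompFunctor.PDelta.{u}.toFunctor ∧
      CompFunctor.HasDegree CompFunctor.PDelta.{u}.toFunctor 3 ∧
      CompFunctor.IsSkeletalFunctor CompFunctor.PDelta.{u}.toFunctor ∧
      ¬ CompFunctor.IsOpenFunctor CompFunctor.PDelta.{u}.toFunctor) ∧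
    ¬ (∀ F : CompHaus.{u} ⥤ CompHaus.{u},
        CompFunctor.IsOneMec F → CompFunctor.IsNormal F → CompFunctor.HasFiniteDegree F →
          CompFunctor.IsSkeletalFunctor F → CompFunctor.IsOpenFunctor F) :=
  ⟨⟨CompFunctor.PDelta_subset_level, CompFunctor.PD_isNormal, CompFunctor.PD_degree,
    CompFunctor.PD_isSkeletal, CompFunctor.PD_not_isOpen⟩, fun h ↦
      CompFunctor.PD_not_isOpen (h _ CompFunctor.PD_isNormal.isOneMec CompFunctor.PD_isNormal
        ⟨3, CompFunctor.PD_degree⟩ CompFunctor.PD_isSkeletal)⟩
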